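/- Let $d\ge 1$ be an integer and let $\alpha\in(1,2)$. Let $\nu_\alpha$ be an $\alpha$-stable Lévy measure on $\mathbb{R}^d$, i.e. a positive Borel measure with $\nu_\alpha(\{0\})=0$, $\int_{\mathbb{R}^d}(1\wedge\|u\|^2)\,\nu_\alpha(du)<+\infty$ and $c^{-\alpha}\nu_\alpha(B/c)=\nu_\alpha(B)$ for all $c>0$ and all Borel sets $B$. Write its polar decomposition as $\nu_\alpha(du)=\mathbf 1_{(0,+\infty)}(r)\mathbf 1_{\mathbb{S}^{d-1}}(y)\frac{dr}{r^{\alpha+1}}\sigma(dy)$, with $\sigma$ a finite positive measure on the Euclidean unit sphere $\mathbb{S}^{d-1}$, and let $\lambda_1=-\cos\left(\frac{\alpha\pi}{2}\right)\frac{\Gamma(2-\alpha)}{\alpha(\alpha-1)}\,\sigma$ be the spectral measure. Assume that $\sigma$ is symmetric ($\sigma(B)=\sigma(-B)$ for all Borel $B\subset\mathbb{S}^{d-1}$) and that $\nu_\alpha$ is non-degenerate: $\inf_{y\in\mathbb{S}^{d-1}}\int_{\mathbb{S}^{d-1}}|\langle y;x\rangle|^\alpha\lambda_1(dx)>0$.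 Let $\mu_\alpha$ be the associated non-degenerate symmetric $\alpha$-stable probability measure on $\mathbb{R}^d$, i.e. for all $\xi\in\mathbb{R}^d$, $$\int_{\mathbb{R}^d}e^{i\langle y;\xi\rangle}\mu_\alpha(dy)=\exp\left(\int_{\mathbb{R}^d}\left(e^{i\langle u;\xi\rangle}-1-i\langle\xi;u\rangle\right)\nu_\alpha(du)\right).$$ Set $$\sigma_\alpha(\xi)=\left(\int_{\mathbb{S}^{d-1}}|\langle y;\xi\rangle|^\alpha\lambda_1(dy)\right)^{1/\alpha},\quad \sigma_\alpha^*(x)=\sup_{\sigma_\alpha(z)\le 1}|\langle x;z\rangle|,\quad K_\alpha=\{z\in\mathbb{R}^d:\sigma_\alpha(z)\le 1\},$$ and let $\mathring K_\alpha=\{x\in\mathbb{R}^d:\langle x;z\rangle\le 1\ \ \forall z\in K_\alpha\}$ be the polar set of $K_\alpha$. For $t\ge 0$ let $P_t^\alpha(f)(x)=\int_{\mathbb{R}^d}f(x+t^{1/\alpha}y)\,\mu_\alpha(dy)$ be the stable heat semigroup, and for Borel sets $A,B$ let $$K_t^\alpha(A,B)=\langle P_t^\alpha(\mathbf 1_A);\mathbf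 1_B\rangle_{L^2(\mathbb{R}^d,dx)}=\int_{B}P_t^\alpha(\mathbf 1_A)(x)\,dx.$$ Finally, for a Borel set $E$ of finite Lebesgue measure, let $$\mathcal{P}_\alpha^{\mathrm{var}}(E)=\sup\left\{\int_E\operatorname{div}(\phi)(x)\,dx:\ \phi\in\mathcal{C}^1_c(\mathbb{R}^d,\mathbb{R}^d),\ \sup_{x}\sigma_\alpha^*(\phi(x))\le 1\right\}.$$ Then $\mathring K_\alpha$ has finite $d$-dimensional Lebesgue measure $\mathcal{L}_d(\mathring K_\alpha)$, and $$\lim_{t\to 0^+}\frac{K_t^\alpha\left(\mathring K_\alpha,(\mathring K_\alpha)^c\right)}{t^{1/\alpha}}=\frac{\Gamma(1-\frac1\alpha)}{\pi}\,d\,\mathcal{L}_d(\mathring K_\alpha)=\frac{\Gamma(1-\frac1\alpha)}{\pi}\,\mathcal{P}_\alpha^{\mathrm{var}}(\mathring K_\alpha).$$ -/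

import Mathlib

open MeasureTheory Set Filter Topology

noncomputable section

namespace StableHeat

/-- The Euclidean space `ℝᵈ`. -/
abbrev E (d : ℕ) : Type := EuclideanSpace ℝ (Fin d)

/-- The Euclidean unit sphere of `ℝᵈ`. -/
abbrev S (d : ℕ) : Type := Metric.sphere (0 : E d) 1

variable {d : ℕ}

/-- `ν` is an `α`-stable Lévy measure: no atom at the origin, `∫ (1 ∧ ‖u‖²) ν(du) < ∞`, and
`c ^ (-α) • T_c ν = ν` for all `c > 0`, where `T_c ν (B) = ν (B / c)`. -/
structure IsStableLevyMeasure (α : ℝ) (ν : Measure (E d)) : Prop where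
  zero : ν {0} = 0
  lintegral_lt_top : ∫⁻ u, ENNReal.ofReal (min 1 (‖u‖ ^ 2)) ∂ν < ⊤
  scaling : ∀ c : ℝ, 0 < c → ENNReal.ofReal (c ^ (-α)) • ν.map (fun u => c • u) = ν

/-- The spherical component `σ` of an `α`-stable Lévy measure `ν`, that is, the measure on the unit
sphere with `ν(du) = 1_{r > 0} dr / r ^ (α + 1) σ(dy)` in polar coordinates `u = r y`
(see `IsStableLevyMeasure.eq_polarMeasure` below). Explicitly,
`σ(B) = α ν {u | 1 ≤ ‖u‖, u / ‖u‖ ∈ B}`. -/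
def sphericalPart (α : ℝ) (ν : Measure (E d)) : Measure (S d) :=
  ENNReal.ofReal α •
    ((ν.restrict {u | 1 ≤ ‖u‖}).map (fun u => ‖u‖⁻¹ • u)).comap (Subtype.val : S d → E d)

/-- The measure `1_{r > 0} dr / r ^ (α + 1) σ(dy)` in polar coordinates `u = r y`. -/
def polarMeasure (α : ℝ) (σ : Measure (S d)) : Measure (E d) :=
  (σ.prod ((volume.restrict (Ioi (0 : ℝ))).withDensity
    (fun r => ENNReal.ofReal (r ^ (-(α + 1)))))).map (fun p => p.2 • (p.1 : E d))

/-- Polar decomposition of `α`-stable Lévy measures, which identifies `sphericalPart`. -/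
theorem IsStableLevyMeasure.eq_polarMeasure {α : ℝ} (hα : 0 < α) {ν : Measure (E d)}
    (hν : IsStableLevyMeasure α ν) : ν = polarMeasure α (sphericalPart α ν) := by
  set ρ : Measure ℝ := (volume.restrict (Ioi (0 : ℝ))).withDensity
    (fun r => ENNReal.ofReal (r ^ (-(α + 1)))) with hρ
  set dir : E d → E d := fun u => ‖u‖⁻¹ • u with hdir
  have mdir : Measurable dir := by fun_prop
  set σ' : Measure (E d) := ENNReal.ofReal α • ((ν.restrict {u | 1 ≤ ‖u‖}).map dir) with hσ'
  have mge : ∀ a : ℝ, MeasurableSet {u : E d | a ≤ ‖u‖} :=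
    fun a => measurableSet_le measurable_const measurable_norm
  have hfin : ν {u | 1 ≤ ‖u‖} < ⊤ := by
    refine lt_of_le_of_lt ?_ hν.lintegral_lt_top
    rw [← lintegral_indicator_one (mge 1)]
    refine lintegral_mono fun u => ?_
    by_cases hu : 1 ≤ ‖u‖
    · rw [indicator_of_mem (by exact hu), min_eq_left (by nlinarith)]
      simp
    · rw [indicator_of_notMem (by exact hu)]
      exact zero_le
  have hscale : ∀ (a : ℝ), 0 < a → ∀ s : Set (E d), MeasurableSet s →
      ν ({u | a ≤ ‖u‖} ∩ dir ⁻¹' s)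
        = ENNReal.ofReal (a ^ (-α)) * ν ({u | 1 ≤ ‖u‖} ∩ dir ⁻¹' s) := by
    intro a ha s hs
    conv_lhs => rw [← hν.scaling a ha]
    rw [Measure.smul_apply, Measure.map_apply (by fun_prop) ((mge a).inter (mdir hs)), smul_eq_mul]
    congr 2
    ext u
    have h1 : dir (a • u) = dir u := by
      simp only [hdir, norm_smul, Real.norm_eq_abs, abs_of_pos ha, smul_smul]
      congr 1
      field_simp
    simp only [mem_preimage, mem_inter_iff, mem_ofPred_eq, h1, norm_smul, Real.norm_eq_abs,
      abs_of_pos ha]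
    exact and_congr_left fun _ => le_mul_iff_one_le_right ha
  have hρIci : ∀ a : ℝ, 0 < a → ρ (Ici a) = ENNReal.ofReal (a ^ (-α) / α) := by
    intro a ha
    rw [hρ, withDensity_apply _ measurableSet_Ici, Measure.restrict_restrict measurableSet_Ici,
      inter_eq_left.2 (Ici_subset_Ioi.2 ha), setLIntegral_congr Ioi_ae_eq_Ici.symm,
      ← ofReal_integral_eq_lintegral_ofReal (integrableOn_Ioi_rpow_of_lt (by linarith) ha),
      integral_Ioi_rpow_of_lt (by linarith) ha]
    · congr 1
      have : -(α + 1) + 1 = -α := by ring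
      rw [this, neg_div_neg_eq]
    · filter_upwards [ae_restrict_mem measurableSet_Ioi] with x hx
      exact Real.rpow_nonneg (ha.trans hx).le _
  have : SigmaFinite ρ := SigmaFinite.withDensity_ofReal _
  have hfr : IsFiniteMeasure (ν.restrict {u : E d | 1 ≤ ‖u‖}) := ⟨by simpa using hfin⟩
  have : IsFiniteMeasure σ' := by
    rw [hσ']
    exact Measure.smul_finite _ ENNReal.ofReal_ne_top
  have hprod : σ'.prod ρ = ν.map (fun u => (dir u, ‖u‖)) := by
    refine Measure.prod_eq fun s t hs ht => ?_
    set m : Measure ℝ := (ν.restrict (dir ⁻¹' s)).map (fun u => ‖u‖) with hm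
    have hmt : ∀ t, MeasurableSet t → m t = ν.map (fun u => (dir u, ‖u‖)) (s ×ˢ t) := by
      intro t ht
      rw [hm, Measure.map_apply measurable_norm ht, Measure.restrict_apply (measurable_norm ht),
        Measure.map_apply (by fun_prop) (hs.prod ht)]
      congr 1
      ext u
      simp [and_comm]
    rw [← hmt t ht]
    have hIci : ∀ a : ℝ, 0 < a → m (Ici a) = (σ' s • ρ) (Ici a) := by
      intro a ha
      rw [hm, Measure.map_apply measurable_norm measurableSet_Ici,
        Measure.restrict_apply (measurable_norm measurableSet_Ici)]
      have : (fun u : E d => ‖u‖) ⁻¹' Ici a ∩ dir ⁻¹' s = {u | a ≤ ‖u‖} ∩ dir ⁻¹' s := rfl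
      rw [this, hscale a ha s hs, Measure.smul_apply, hρIci a ha, hσ', Measure.smul_apply,
        Measure.map_apply mdir hs, Measure.restrict_apply (mdir hs), inter_comm, smul_eq_mul,
        smul_eq_mul, mul_right_comm, ← ENNReal.ofReal_mul hα.le, mul_div_cancel₀ _ hα.ne']
    suffices m = σ' s • ρ by rw [this, Measure.smul_apply, smul_eq_mul]
    refine (Measure.ext_iff_of_iUnion_eq_univ
      (s := fun o : Option ℕ => o.elim (Iic (0 : ℝ)) (fun n => Ici (1 / ((n : ℝ) + 1)))) ?_).2 ?_
    · refine eq_univ_of_forall fun x => mem_iUnion.2 ?_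
      rcases le_or_gt x 0 with hx | hx
      · exact ⟨none, hx⟩
      · obtain ⟨n, hn⟩ := exists_nat_one_div_lt hx
        exact ⟨some n, hn.le⟩
    · rintro (_ | n)
      · have h1 : m (Iic 0) = 0 := by
          rw [hm, Measure.map_apply measurable_norm measurableSet_Iic]
          refine le_antisymm ((Measure.restrict_apply_le _ _).trans ?_) zero_le
          refine (measure_mono fun u hu => ?_).trans hν.zero.le
          simpa using hu
        have h2 : (σ' s • ρ) (Iic 0) = 0 := by
          rw [Measure.smul_apply, hρ, withDensity_apply _ measurableSet_Iic,
            Measure.restrict_restrict measurableSet_Iic, Iic_inter_Ioi, Ioc_self]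
          simp
        simp only [Option.elim_none]
        rw [Measure.restrict_eq_zero.2 h1, Measure.restrict_eq_zero.2 h2]
      · have hn : 0 < 1 / ((n : ℝ) + 1) := by positivity
        simp only [Option.elim_some]
        have : IsFiniteMeasure (m.restrict (Ici (1 / ((n : ℝ) + 1)))) := by
          refine ⟨?_⟩
          rw [Measure.restrict_apply_univ, hIci _ hn, Measure.smul_apply, hρIci _ hn]
          exact ENNReal.mul_lt_top (measure_lt_top _ _) ENNReal.ofReal_lt_top
        refine Measure.ext_of_Ici _ _ fun a => ?_
        rw [Measure.restrict_apply measurableSet_Ici, Measure.restrict_apply measurableSet_Ici,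
          Ici_inter_Ici]
        exact hIci _ (lt_of_lt_of_le hn le_sup_right)
  have hval : (sphericalPart α ν).map (Subtype.val : S d → E d) = σ' := by
    have hemb : MeasurableEmbedding (Subtype.val : S d → E d) :=
      MeasurableEmbedding.subtype_coe Metric.isClosed_sphere.measurableSet
    rw [sphericalPart, Measure.map_smul, hemb.map_comap, hσ']
    congr 1
    refine Measure.restrict_eq_self_of_ae_mem ?_
    rw [Subtype.range_coe]
    refine (ae_map_iff (p := fun x => x ∈ Metric.sphere (0 : E d) 1) mdir.aemeasurable
      Metric.isClosed_sphere.measurableSet).2 ?_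
    filter_upwards [ae_restrict_mem (mge 1)] with u hu
    have hu' : ‖u‖ ≠ 0 := by
      have : (1 : ℝ) ≤ ‖u‖ := hu
      positivity
    simp [hdir, norm_smul, inv_mul_cancel₀ hu']
  have hsf : SFinite (sphericalPart α ν) := by
    have : IsFiniteMeasure (sphericalPart α ν) := by
      refine ⟨?_⟩
      have h := measure_lt_top σ' univ
      rwa [← hval, Measure.map_apply measurable_subtype_coe MeasurableSet.univ,
        preimage_univ] at h
    infer_instance
  have hpol : polarMeasure α (sphericalPart α ν)
      = (σ'.prod ρ).map (fun p : E d × ℝ => p.2 • p.1) := by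
    conv_rhs => rw [← hval, ← Measure.map_id (μ := ρ)]
    rw [Measure.map_prod_map _ _ measurable_subtype_coe measurable_id,
      Measure.map_map (by fun_prop) (by fun_prop)]
    rfl
  rw [hpol, hprod, Measure.map_map (by fun_prop) (by fun_prop)]
  conv_lhs => rw [← Measure.map_id (μ := ν)]
  refine Measure.map_congr (Eventually.of_forall fun u => ?_)
  rcases eq_or_ne u 0 with rfl | hu
  · simp [hdir]
  · simp [hdir, smul_smul, mul_inv_cancel₀ (norm_ne_zero_iff.2 hu)]

/-- The spectral measure `λ₁ = - cos (α π / 2) Γ(2 - α) / (α (α - 1)) σ`. -/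
def spectralMeasure (α : ℝ) (ν : Measure (E d)) : Measure (S d) :=
  ENNReal.ofReal (-Real.cos (α * (Real.pi / 2)) * (Real.Gamma (2 - α) / (α * (α - 1)))) •
    sphericalPart α ν

/-- Symmetry of the spherical component: `σ(B) = σ(-B)` for all Borel subsets of the sphere. -/
def IsSymmetric (α : ℝ) (ν : Measure (E d)) : Prop :=
  ∀ B : Set (S d), MeasurableSet B → sphericalPart α ν ((fun y => -y) ⁻¹' B) = sphericalPart α ν B

/-- Non-degeneracy: `inf_{y} ∫ |⟨y ; x⟩| ^ α λ₁(dx) > 0`, the infimum running over the sphere. -/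
def IsNondegenerate (α : ℝ) (ν : Measure (E d)) : Prop :=
  0 < ⨅ y : S d, ∫ x : S d, |inner ℝ (y : E d) (x : E d)| ^ α ∂(spectralMeasure α ν)

/-- `μ` is the stable law with Lévy measure `ν`: its Fourier transform is
`ξ ↦ exp (∫ (e ^ (i ⟨u ; ξ⟩) - 1 - i ⟨ξ ; u⟩) ν(du))`. -/
def IsStableLaw (ν μ : Measure (E d)) : Prop :=
  ∀ ξ : E d, ∫ y, Complex.exp (Complex.I * (inner ℝ y ξ : ℝ)) ∂μ =
    Complex.exp (∫ u, (Complex.exp (Complex.I * (inner ℝ u ξ : ℝ)) - 1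
      - Complex.I * (inner ℝ ξ u : ℝ)) ∂ν)

/-- `σ_α(ξ) = (∫ |⟨y ; ξ⟩| ^ α λ₁(dy)) ^ (1 / α)`. -/
def sigmaNorm (α : ℝ) (ν : Measure (E d)) (ξ : E d) : ℝ :=
  (∫ y : S d, |inner ℝ (y : E d) ξ| ^ α ∂(spectralMeasure α ν)) ^ (1 / α)

/-- The dual norm `σ_α^*(x) = sup {|⟨x ; z⟩| : σ_α(z) ≤ 1}`. -/
def sigmaDual (α : ℝ) (ν : Measure (E d)) (x : E d) : ℝ :=
  sSup ((fun z : E d => |inner ℝ x z|) '' {z | sigmaNorm α ν z ≤ 1})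

/-- The unit ball `K_α` of `σ_α`. -/
def unitBall (α : ℝ) (ν : Measure (E d)) : Set (E d) := {z | sigmaNorm α ν z ≤ 1}

/-- The polar set of `K_α`. -/
def polarBody (α : ℝ) (ν : Measure (E d)) : Set (E d) :=
  {x | ∀ z ∈ unitBall α ν, inner ℝ x z ≤ 1}

/-- The stable heat semigroup `P_t^α f (x) = ∫ f (x + t ^ (1 / α) y) μ(dy)`. -/
def heatSemigroup (α : ℝ) (μ : Measure (E d)) (t : ℝ) (f : E d → ℝ) (x : E d) : ℝ :=
  ∫ y, f (x + t ^ (1 / α) • y) ∂μ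

/-- `K_t^α(A, B) = ⟨P_t^α 1_A ; 1_B⟩`, the pairing being that of `L²(dx)`. -/
def heatK (α : ℝ) (μ : Measure (E d)) (t : ℝ) (A B : Set (E d)) : ℝ :=
  ∫ x, heatSemigroup α μ t (A.indicator 1) x * B.indicator 1 x

/-- The divergence of a vector field on `ℝᵈ`. -/
def divergence (φ : E d → E d) (x : E d) : ℝ :=
  ∑ i : Fin d, (fderiv ℝ φ x (EuclideanSpace.single i 1)) i

/-- The anisotropic perimeter: the supremum (in the extended reals) of `∫_A div φ dx` over all
compactly supported `C¹` vector fields `φ` with `sup_x σ_α^*(φ(x)) ≤ 1`. -/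
def perimeterVar (α : ℝ) (ν : Measure (E d)) (A : Set (E d)) : EReal :=
  ⨆ φ ∈ {φ : E d → E d | ContDiff ℝ 1 φ ∧ HasCompactSupport φ ∧ ∀ x, sigmaDual α ν (φ x) ≤ 1},
    ((∫ x in A, divergence φ x : ℝ) : EReal)

end StableHeat

end

/-!
Write `p = σ_α^*`, a norm whose unit ball is the polar body `C`, and put `s = t ^ (1 / α)`. By
Fubini the heat content `K_t(C, Cᶜ)` equals `G(s) = ∫ |{x ∈ C : x - s y ∉ C}| μ(dy)`.

No surface measure is needed to find the first-order behaviour of `G`. The function `G` is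
subadditive and `O(s)`, so `G(s) / s` has a limit `L` as `s → 0⁺`
(`exists_tendsto_div_of_subadditive`). To compute `L`, average over the dilates `r C`, `0 < r < 1`:
by scaling and Fubini,
`∫₀¹ r ^ d G(s / r) dr = ∫ ∫ (min (p (x - s y)) 1 - p x)₊ dx μ(dy)`
(`lintegral_pow_mul_exitVolume`). After division by `s`, the left-hand side tends to `L / d`. Since `p` is Lipschitz, Rademacher's
theorem and dominated convergence show that the right-hand side tends to
`∫_C ∫ ⟨∇p(x) ; -y⟩₊ μ(dy) dx` (`tendsto_lintegral_increment`).

The inner integral is evaluated from the characteristic function. In polar coordinates, and using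
the symmetry of `σ`, the Lévy exponent is `-σ_α(ξ) ^ α` (`levyExponent_eq`), so `μ` is symmetric, and
`|z| = (2 / π) ∫₀^∞ (1 - cos (z u)) u⁻² du` yields `∫ ⟨n ; -y⟩₊ μ(dy) = Γ(1 - 1 / α) / π * σ_α(n)`
(`IsStableLaw.lintegral_neg_inner`). The bipolar theorem gives the eikonal equation `σ_α(∇p) = 1`
wherever `p` is differentiable (`exists_gradient_sigmaNorm_eq_one`), whence
`L = d Γ(1 - 1 / α) / π * |C|`.

Finally the anisotropic perimeter of `C` is `d |C|`: integration by parts against a Lipschitz cutoff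
of `p` bounds it from above (`integral_divergence_le`), and truncations of the radial fields
`x ↦ δ x`, `δ < 1`, bound it from below (`exists_field_integral_divergence_eq`).
-/

namespace StableHeat

variable {d : ℕ}

/-! ### One-dimensional integrals -/

/-- Transfer of an integral with positive value to `ENNReal`; integrability is automatic because a
non-integrable function has integral `0`. -/
theorem setLIntegral_ofReal_eq {s : Set ℝ} (hs : MeasurableSet s) {f : ℝ → ℝ} {c : ℝ}
    (hc : 0 < c) (hf : ∀ x ∈ s, 0 ≤ f x) (h : ∫ x in s, f x = c) :
    ∫⁻ x in s, ENNReal.ofReal (f x) = ENNReal.ofReal c := by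
  have hi : IntegrableOn f s := not_imp_comm.1 integral_undef (by rw [h]; exact hc.ne')
  rw [← h, ofReal_integral_eq_lintegral_ofReal hi]
  exact (ae_restrict_iff' hs).2 (Eventually.of_forall hf)

theorem integral_one_sub_cos_mul_exp {a v : ℝ} (hv : 0 < v) :
    ∫ r in Ioi (0 : ℝ), (1 - Real.cos (a * r)) * Real.exp (-(v * r))
      = a ^ 2 / (v * (v ^ 2 + a ^ 2)) := by
  have hden : v ^ 2 + a ^ 2 ≠ 0 := by positivity
  -- An antiderivative of the integrand that vanishes at infinity.
  set F : ℝ → ℝ := fun r => Real.exp (-(v * r)) *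
    (-1 / v - (a * Real.sin (a * r) - v * Real.cos (a * r)) / (v ^ 2 + a ^ 2)) with hF
  have hd : ∀ r, HasDerivAt F ((1 - Real.cos (a * r)) * Real.exp (-(v * r))) r := by
    intro r
    have h1 : HasDerivAt (fun r => Real.exp (-(v * r))) (Real.exp (-(v * r)) * (-(v * 1))) r :=
      (((hasDerivAt_id r).const_mul v).neg).exp
    have hs : HasDerivAt (fun r => Real.sin (a * r)) (Real.cos (a * r) * (a * 1)) r :=
      ((hasDerivAt_id r).const_mul a).sin
    have hc : HasDerivAt (fun r => Real.cos (a * r)) (-Real.sin (a * r) * (a * 1)) r :=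
      ((hasDerivAt_id r).const_mul a).cos
    have h2 := h1.mul ((((hs.const_mul a).sub (hc.const_mul v)).div_const (v ^ 2 + a ^ 2)).const_sub
      (-1 / v))
    refine h2.congr_deriv ?_
    simp only [Pi.sub_apply]
    field_simp
    ring
  have hlim : Tendsto F atTop (𝓝 0) := by
    have he : Tendsto (fun r : ℝ => Real.exp (-(v * r))) atTop (𝓝 0) :=
      Real.tendsto_exp_neg_atTop_nhds_zero.comp (tendsto_id.const_mul_atTop hv)
    refine he.zero_mul_isBoundedUnder_le ⟨1 / v + (|a| + v) / (v ^ 2 + a ^ 2), ?_⟩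
    refine eventually_map.2 (Eventually.of_forall fun r => ?_)
    simp only [Function.comp, Real.norm_eq_abs]
    have h3 : |a * Real.sin (a * r) - v * Real.cos (a * r)| ≤ |a| + v := by
      refine (abs_sub _ _).trans ?_
      rw [abs_mul, abs_mul, abs_of_pos hv]
      have := Real.abs_sin_le_one (a * r)
      have := Real.abs_cos_le_one (a * r)
      nlinarith [abs_nonneg a]
    refine (abs_sub _ _).trans ?_
    rw [abs_div, abs_div, abs_neg, abs_one, abs_of_pos hv,
      abs_of_pos (by positivity : 0 < v ^ 2 + a ^ 2)]
    gcongr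
  rw [integral_Ioi_of_hasDerivAt_of_nonneg' (fun r _ => hd r) (fun r _ => ?_) hlim]
  · simp only [hF, mul_zero, neg_zero, Real.exp_zero, Real.sin_zero, Real.cos_zero]
    field_simp
    ring
  · exact mul_nonneg (by linarith [Real.cos_le_one (a * r)]) (Real.exp_pos _).le

/-- The constant of the one-dimensional stable exponent. First `r ^ (-(β + 1))` and then
`1 / (v ^ 2 + a ^ 2)` is written as a Laplace transform and the order of integration exchanged;
Euler's reflection formula gives the final form. -/
theorem lintegral_one_sub_cos_mul_rpow {β a : ℝ} (hβ0 : 0 < β) (hβ2 : β < 2) (ha : 0 < a) :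
    ∫⁻ r in Ioi (0 : ℝ), ENNReal.ofReal ((1 - Real.cos (a * r)) * r ^ (-(β + 1)))
      = ENNReal.ofReal (a ^ β * (Real.pi / (2 * Real.sin (Real.pi * (β / 2)) *
          Real.Gamma (β + 1)))) := by
  have hG : 0 < Real.Gamma (β + 1) := Real.Gamma_pos_of_pos (by linarith)
  have hcos : ∀ r, 0 ≤ 1 - Real.cos (a * r) := fun r => by linarith [Real.cos_le_one (a * r)]
  have key : ENNReal.ofReal (Real.Gamma (β + 1)) *
      ∫⁻ r in Ioi (0 : ℝ), ENNReal.ofReal ((1 - Real.cos (a * r)) * r ^ (-(β + 1)))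
      = ENNReal.ofReal (a ^ 2 * (1 / 2 * Real.Gamma (β / 2)) *
        ((1 / a ^ 2) ^ (1 - β / 2) * Real.Gamma (1 - β / 2))) := by
    rw [← lintegral_const_mul _ (by fun_prop)]
    calc ∫⁻ r in Ioi (0 : ℝ), ENNReal.ofReal (Real.Gamma (β + 1)) *
          ENNReal.ofReal ((1 - Real.cos (a * r)) * r ^ (-(β + 1)))
        = ∫⁻ r in Ioi (0 : ℝ), ∫⁻ v in Ioi (0 : ℝ),
            ENNReal.ofReal ((1 - Real.cos (a * r)) * (v ^ β * Real.exp (-(r * v)))) := by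
          refine setLIntegral_congr_fun measurableSet_Ioi fun r (hr : 0 < r) => ?_
          have h1 : ∫⁻ v in Ioi (0 : ℝ), ENNReal.ofReal (v ^ β * Real.exp (-(r * v)))
              = ENNReal.ofReal ((1 / r) ^ (β + 1) * Real.Gamma (β + 1)) := by
            refine setLIntegral_ofReal_eq measurableSet_Ioi (by positivity)
              (fun v (hv : 0 < v) => by positivity) ?_
            have := Real.integral_rpow_mul_exp_neg_mul_Ioi (a := β + 1) (by linarith) hr
            simpa using this
          simp_rw [ENNReal.ofReal_mul (hcos r)]
          rw [lintegral_const_mul _ (by fun_prop), h1, one_div, Real.inv_rpow hr.le,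
            ← Real.rpow_neg hr.le, mul_comm _ (Real.Gamma (β + 1)),
            ENNReal.ofReal_mul hG.le]
          ring
      _ = ∫⁻ v in Ioi (0 : ℝ), ∫⁻ r in Ioi (0 : ℝ),
            ENNReal.ofReal ((1 - Real.cos (a * r)) * (v ^ β * Real.exp (-(r * v)))) :=
          lintegral_lintegral_swap (by fun_prop)
      _ = ∫⁻ v in Ioi (0 : ℝ), ∫⁻ w in Ioi (0 : ℝ),
            ENNReal.ofReal (a ^ 2 * v ^ (β - 1) * Real.exp (-((v ^ 2 + a ^ 2) * w))) := by
          refine setLIntegral_congr_fun measurableSet_Ioi fun v (hv : 0 < v) => ?_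
          have h1 : ∫⁻ r in Ioi (0 : ℝ),
              ENNReal.ofReal ((1 - Real.cos (a * r)) * Real.exp (-(v * r)))
              = ENNReal.ofReal (a ^ 2 / (v * (v ^ 2 + a ^ 2))) :=
            setLIntegral_ofReal_eq measurableSet_Ioi (by positivity)
              (fun r _ => mul_nonneg (hcos r) (Real.exp_pos _).le) (integral_one_sub_cos_mul_exp hv)
          have h2 : ∫⁻ w in Ioi (0 : ℝ), ENNReal.ofReal (Real.exp (-((v ^ 2 + a ^ 2) * w)))
              = ENNReal.ofReal (1 / (v ^ 2 + a ^ 2)) := by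
            refine setLIntegral_ofReal_eq measurableSet_Ioi (by positivity)
              (fun w _ => by positivity) ?_
            have := Real.integral_rpow_mul_exp_neg_mul_Ioi (a := 1) one_pos
              (by positivity : 0 < v ^ 2 + a ^ 2)
            simpa using this
          have e1 : ∀ r, ENNReal.ofReal ((1 - Real.cos (a * r)) * (v ^ β * Real.exp (-(r * v))))
              = ENNReal.ofReal (v ^ β) *
                ENNReal.ofReal ((1 - Real.cos (a * r)) * Real.exp (-(v * r))) := fun r => by
            rw [← ENNReal.ofReal_mul (by positivity)]
            congr 1
            rw [mul_comm r v]; ring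
          have e2 : ∀ w, ENNReal.ofReal (a ^ 2 * v ^ (β - 1) * Real.exp (-((v ^ 2 + a ^ 2) * w)))
              = ENNReal.ofReal (a ^ 2 * v ^ (β - 1)) *
                ENNReal.ofReal (Real.exp (-((v ^ 2 + a ^ 2) * w))) := fun w =>
            ENNReal.ofReal_mul (by positivity)
          simp_rw [e1, e2]
          rw [lintegral_const_mul _ (by fun_prop), lintegral_const_mul _ (by fun_prop), h1, h2,
            ← ENNReal.ofReal_mul (by positivity), ← ENNReal.ofReal_mul (by positivity),
            Real.rpow_sub_one hv.ne']
          congr 1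
          field_simp
      _ = ∫⁻ w in Ioi (0 : ℝ), ∫⁻ v in Ioi (0 : ℝ),
            ENNReal.ofReal (a ^ 2 * v ^ (β - 1) * Real.exp (-((v ^ 2 + a ^ 2) * w))) :=
          lintegral_lintegral_swap (by fun_prop)
      _ = ∫⁻ w in Ioi (0 : ℝ), ENNReal.ofReal (a ^ 2 * (1 / 2 * Real.Gamma (β / 2))) *
            ENNReal.ofReal (w ^ (1 - β / 2 - 1) * Real.exp (-(a ^ 2 * w))) := by
          refine setLIntegral_congr_fun measurableSet_Ioi fun w (hw : 0 < w) => ?_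
          have hG2 : 0 < Real.Gamma (β / 2) := Real.Gamma_pos_of_pos (by linarith)
          have h1 : ∫⁻ v in Ioi (0 : ℝ), ENNReal.ofReal (v ^ (β - 1) * Real.exp (-w * v ^ (2 : ℝ)))
              = ENNReal.ofReal (w ^ (-(β - 1 + 1) / 2) * (1 / 2) *
                Real.Gamma ((β - 1 + 1) / 2)) := by
            refine setLIntegral_ofReal_eq measurableSet_Ioi ?_
              (fun v (hv : 0 < v) => by positivity)
              (integral_rpow_mul_exp_neg_mul_rpow (by norm_num) (by linarith) hw)
            have : (β - 1 + 1) / 2 = β / 2 := by ring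
            rw [this]; positivity
          have e1 : ∀ v, ENNReal.ofReal (a ^ 2 * v ^ (β - 1) * Real.exp (-((v ^ 2 + a ^ 2) * w)))
              = ENNReal.ofReal (a ^ 2 * Real.exp (-(a ^ 2 * w))) *
                ENNReal.ofReal (v ^ (β - 1) * Real.exp (-w * v ^ (2 : ℝ))) := fun v => by
            rw [← ENNReal.ofReal_mul (by positivity)]
            congr 1
            have : -((v ^ 2 + a ^ 2) * w) = -(a ^ 2 * w) + -w * v ^ 2 := by ring
            rw [this, Real.exp_add, Real.rpow_two]; ring
          simp_rw [e1]
          rw [lintegral_const_mul _ (by fun_prop), h1, ← ENNReal.ofReal_mul (by positivity),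
            ← ENNReal.ofReal_mul (by positivity)]
          have e3 : -(β - 1 + 1) / 2 = 1 - β / 2 - 1 := by ring
          have e4 : (β - 1 + 1) / 2 = β / 2 := by ring
          rw [e3, e4]
          congr 1
          ring
      _ = _ := by
          have hG2 : 0 < Real.Gamma (β / 2) := Real.Gamma_pos_of_pos (by linarith)
          have hG3 : 0 < Real.Gamma (1 - β / 2) := Real.Gamma_pos_of_pos (by linarith)
          rw [lintegral_const_mul _ (by fun_prop),
            setLIntegral_ofReal_eq measurableSet_Ioi (by positivity)
              (fun w (hw : 0 < w) => by positivity)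
              (Real.integral_rpow_mul_exp_neg_mul_Ioi (by linarith) (by positivity : 0 < a ^ 2)),
            ← ENNReal.ofReal_mul (by positivity)]
  have hsin : 0 < Real.sin (Real.pi * (β / 2)) :=
    Real.sin_pos_of_pos_of_lt_pi (by positivity) (by nlinarith [Real.pi_pos])
  rw [← ENNReal.mul_right_inj (ENNReal.ofReal_pos.2 hG).ne' ENNReal.ofReal_ne_top, key,
    ← ENNReal.ofReal_mul hG.le]
  congr 1
  have hpow : a ^ 2 * (1 / a ^ 2) ^ (1 - β / 2) = a ^ β := by
    rw [one_div, Real.inv_rpow (by positivity), ← Real.rpow_neg (by positivity),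
      ← Real.rpow_natCast, ← Real.rpow_mul ha.le, ← Real.rpow_add ha]
    congr 1
    push_cast; ring
  calc _ = a ^ 2 * (1 / a ^ 2) ^ (1 - β / 2) * (1 / 2) *
          (Real.Gamma (β / 2) * Real.Gamma (1 - β / 2)) := by ring
    _ = _ := by
      rw [hpow, Real.Gamma_mul_Gamma_one_sub]
      field_simp

/-- At exponent `1` this represents `|z|` as a mixture of `1 - cos (z r)`. -/
theorem lintegral_one_sub_cos_mul_rpow_neg_two (z : ℝ) :
    ∫⁻ r in Ioi (0 : ℝ), ENNReal.ofReal ((1 - Real.cos (z * r)) * r ^ (-2 : ℝ))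
      = ENNReal.ofReal (Real.pi / 2 * |z|) := by
  rcases eq_or_ne z 0 with rfl | hz
  · simp
  have h := lintegral_one_sub_cos_mul_rpow (β := 1) (a := |z|) one_pos (by norm_num)
    (abs_pos.2 hz)
  have hc : ∀ r, Real.cos (|z| * r) = Real.cos (z * r) := fun r => by
    rcases abs_choice z with h | h <;> rw [h]
    rw [neg_mul, Real.cos_neg]
  have e1 : Real.sin (Real.pi * (1 / 2)) = 1 := by
    rw [mul_one_div]; exact Real.sin_pi_div_two
  have e2 : Real.Gamma (1 + 1) = 1 := by norm_num
  have e3 : -((1 : ℝ) + 1) = -2 := by norm_num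
  rw [e1, e2, e3] at h
  simp_rw [hc] at h
  rw [h]
  congr 1
  rw [Real.rpow_one]
  ring

/-- Proved by writing `1 - exp (-c u ^ α)` as an integral over `w ∈ (0, c]` and exchanging the order
of integration. -/
theorem lintegral_one_sub_exp_mul_rpow_neg_two {α c : ℝ} (hα : 1 < α) (hc : 0 ≤ c) :
    ∫⁻ u in Ioi (0 : ℝ), ENNReal.ofReal ((1 - Real.exp (-(c * u ^ α))) * u ^ (-2 : ℝ))
      = ENNReal.ofReal (c ^ (1 / α) * Real.Gamma (1 - 1 / α)) := by
  have hα0 : 0 < α := by linarith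
  rcases hc.eq_or_lt with rfl | hc
  · simp [Real.zero_rpow (inv_ne_zero hα0.ne')]
  have h1α : 1 / α < 1 := by rw [div_lt_one hα0]; exact hα
  have hG : 0 < Real.Gamma (1 - 1 / α) := Real.Gamma_pos_of_pos (by linarith)
  calc ∫⁻ u in Ioi (0 : ℝ), ENNReal.ofReal ((1 - Real.exp (-(c * u ^ α))) * u ^ (-2 : ℝ))
      = ∫⁻ u in Ioi (0 : ℝ), ∫⁻ w in Ioc 0 c,
          ENNReal.ofReal (u ^ (α - 2) * Real.exp (-w * u ^ α)) := by
        refine setLIntegral_congr_fun measurableSet_Ioi fun u (hu : 0 < u) => ?_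
        have hb : 0 < u ^ α := by positivity
        have hd : ∀ w, HasDerivAt (fun w => -Real.exp (-w * u ^ α))
            (u ^ α * Real.exp (-w * u ^ α)) w := fun w => by
          have := ((((hasDerivAt_id w).neg).mul_const (u ^ α)).exp).neg
          refine this.congr_deriv ?_
          simp; ring
        have h1 : ∫ w in Ioc 0 c, u ^ α * Real.exp (-w * u ^ α) = 1 - Real.exp (-(c * u ^ α)) := by
          rw [← intervalIntegral.integral_of_le hc.le,
            intervalIntegral.integral_eq_sub_of_hasDerivAt (fun w _ => hd w)
              (Continuous.intervalIntegrable (by fun_prop) _ _)]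
          simp
          ring
        have h2 : ∫⁻ w in Ioc 0 c, ENNReal.ofReal (u ^ α * Real.exp (-w * u ^ α))
            = ENNReal.ofReal (1 - Real.exp (-(c * u ^ α))) := by
          refine setLIntegral_ofReal_eq measurableSet_Ioc ?_ (fun w _ => by positivity) h1
          have : Real.exp (-(c * u ^ α)) < 1 := Real.exp_lt_one_iff.2 (by nlinarith)
          linarith
        have e1 : ∀ w, ENNReal.ofReal (u ^ (α - 2) * Real.exp (-w * u ^ α))
            = ENNReal.ofReal (u ^ (-2 : ℝ)) * ENNReal.ofReal (u ^ α * Real.exp (-w * u ^ α)) :=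
          fun w => by
            rw [← ENNReal.ofReal_mul (by positivity), ← mul_assoc, ← Real.rpow_add hu]
            congr 4
            ring
        simp_rw [e1]
        rw [lintegral_const_mul _ (by fun_prop), h2, ← ENNReal.ofReal_mul (by positivity), mul_comm]
    _ = ∫⁻ w in Ioc 0 c, ∫⁻ u in Ioi (0 : ℝ),
          ENNReal.ofReal (u ^ (α - 2) * Real.exp (-w * u ^ α)) :=
        lintegral_lintegral_swap (by fun_prop)
    _ = ∫⁻ w in Ioc 0 c, ENNReal.ofReal (1 / α * Real.Gamma (1 - 1 / α)) *
          ENNReal.ofReal (w ^ (1 / α - 1)) := by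
        refine setLIntegral_congr_fun measurableSet_Ioc fun w hw => ?_
        have hw0 : 0 < w := hw.1
        have e1 : (α - 2 + 1) / α = 1 - 1 / α := by field_simp; ring
        have e2 : -(α - 2 + 1) / α = 1 / α - 1 := by field_simp; ring
        have h := integral_rpow_mul_exp_neg_mul_rpow hα0 (by linarith : -1 < α - 2) hw0
        rw [e1, e2] at h
        rw [← ENNReal.ofReal_mul (by positivity)]
        rw [setLIntegral_ofReal_eq measurableSet_Ioi (by positivity)
          (fun u (hu : 0 < u) => by positivity) h]
        congr 1; ring
    _ = _ := by
        have h : ∫ w in Ioc 0 c, w ^ (1 / α - 1) = α * c ^ (1 / α) := by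
          have h0 : 0 < 1 / α := by positivity
          rw [← intervalIntegral.integral_of_le hc.le, integral_rpow (Or.inl (by linarith))]
          rw [sub_add_cancel, Real.zero_rpow h0.ne']
          field_simp
          simp
        rw [lintegral_const_mul _ (by fun_prop),
          setLIntegral_ofReal_eq measurableSet_Ioc (by positivity)
          (fun w hw => by have := hw.1; positivity) h, ← ENNReal.ofReal_mul (by positivity)]
        congr 1
        field_simp

/-! ### The Lévy exponent and first moments of the stable law -/

section Levy

variable {α : ℝ} {ν : Measure (E d)}

theorem IsStableLevyMeasure.isFiniteMeasure_sphericalPart (hν : IsStableLevyMeasure α ν) :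
    IsFiniteMeasure (sphericalPart α ν) := by
  have hm : MeasurableSet {u : E d | 1 ≤ ‖u‖} := measurableSet_le measurable_const measurable_norm
  have hfin : ν {u | 1 ≤ ‖u‖} < ⊤ := by
    refine lt_of_le_of_lt ?_ hν.lintegral_lt_top
    rw [← lintegral_indicator_one hm]
    refine lintegral_mono (indicator_le fun u hu => ?_)
    have hu' : 1 ≤ ‖u‖ := hu
    rw [min_eq_left (by nlinarith)]
    simp
  have hemb : MeasurableEmbedding (Subtype.val : S d → E d) :=
    MeasurableEmbedding.subtype_coe Metric.isClosed_sphere.measurableSet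
  have : IsFiniteMeasure (ν.restrict {u : E d | 1 ≤ ‖u‖}) := ⟨by simpa using hfin⟩
  have : IsFiniteMeasure (((ν.restrict {u | 1 ≤ ‖u‖}).map
      (fun u : E d => ‖u‖⁻¹ • u)).comap (Subtype.val : S d → E d)) :=
    ⟨by rw [hemb.comap_apply]; exact measure_lt_top _ _⟩
  exact Measure.smul_finite _ ENNReal.ofReal_ne_top

theorem IsStableLevyMeasure.isFiniteMeasure_spectralMeasure (hν : IsStableLevyMeasure α ν) :
    IsFiniteMeasure (spectralMeasure α ν) := by
  have := hν.isFiniteMeasure_sphericalPart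
  exact Measure.smul_finite _ ENNReal.ofReal_ne_top

theorem lintegral_polarMeasure (σ : Measure (S d)) [SFinite σ] {F : E d → ENNReal}
    (hF : Measurable F) :
    ∫⁻ u, F u ∂(polarMeasure α σ)
      = ∫⁻ y, (∫⁻ r in Ioi (0 : ℝ), ENNReal.ofReal (r ^ (-(α + 1))) * F (r • (y : E d))) ∂σ := by
  have : SigmaFinite ((volume.restrict (Ioi (0 : ℝ))).withDensity
    (fun r => ENNReal.ofReal (r ^ (-(α + 1))))) := SigmaFinite.withDensity_ofReal _
  rw [polarMeasure, lintegral_map hF (by fun_prop), lintegral_prod _ (by fun_prop)]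
  refine lintegral_congr fun y => ?_
  rw [lintegral_withDensity_eq_lintegral_mul _ (by fun_prop) (by fun_prop)]
  rfl

theorem lintegral_levyMeasure (hα : 0 < α) (hν : IsStableLevyMeasure α ν) {F : E d → ENNReal}
    (hF : Measurable F) :
    ∫⁻ u, F u ∂ν = ∫⁻ y, (∫⁻ r in Ioi (0 : ℝ),
      ENNReal.ofReal (r ^ (-(α + 1))) * F (r • (y : E d))) ∂(sphericalPart α ν) := by
  have := hν.isFiniteMeasure_sphericalPart
  conv_lhs => rw [hν.eq_polarMeasure hα]
  exact lintegral_polarMeasure _ hF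

theorem map_neg_levyMeasure (hα : 0 < α) (hν : IsStableLevyMeasure α ν)
    (hsymm : IsSymmetric α ν) : ν.map (fun u => -u) = ν := by
  have hσ : (sphericalPart α ν).map (fun y => -y) = sphericalPart α ν := by
    refine Measure.ext fun B hB => ?_
    rw [Measure.map_apply continuous_neg.measurable hB]
    exact hsymm B hB
  refine Measure.ext_of_lintegral _ fun F hF => ?_
  have := hν.isFiniteMeasure_sphericalPart
  rw [lintegral_map hF measurable_neg, lintegral_levyMeasure (F := fun u => F (-u)) hα hν
      (hF.comp measurable_neg),
    lintegral_levyMeasure hα hν hF]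
  conv_rhs => rw [← hσ]
  have hm : Measurable fun y : S d => ∫⁻ r in Ioi (0 : ℝ),
      ENNReal.ofReal (r ^ (-(α + 1))) * F (r • (y : E d)) := by
    have : Measurable fun q : S d × ℝ =>
        ENNReal.ofReal (q.2 ^ (-(α + 1))) * F (q.2 • (q.1 : E d)) := by fun_prop
    exact this.lintegral_prod_right'
  rw [lintegral_map hm continuous_neg.measurable]
  simp

theorem norm_exp_I_mul_sub_one_sub_le (a : ℝ) :
    ‖Complex.exp (Complex.I * a) - 1 - Complex.I * a‖ ≤ 2 * min (a ^ 2) |a| := by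
  have hn : ‖Complex.I * (a : ℂ)‖ = |a| := by simp
  rcases le_or_gt |a| 1 with h | h
  · have h1 := Complex.norm_exp_sub_one_sub_id_le (x := Complex.I * a) (by rwa [hn])
    rw [hn, sq_abs] at h1
    have h2 : a ^ 2 ≤ |a| := by rw [← sq_abs]; nlinarith [abs_nonneg a]
    rw [min_eq_left h2]
    nlinarith [sq_nonneg a]
  · have h2 : |a| ≤ a ^ 2 := by rw [← sq_abs]; nlinarith
    rw [min_eq_right h2]
    have h3 : ‖Complex.exp (Complex.I * a) - 1‖ ≤ |a| := by
      simpa using Real.norm_exp_I_mul_ofReal_sub_one_le (x := a)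
    have := norm_sub_le (Complex.exp (Complex.I * a) - 1) (Complex.I * a)
    rw [hn] at this
    linarith

/-- The Lévy measure integrates `‖u‖ ^ 2` near the origin, as `α < 2`, and `‖u‖` at infinity, as
`1 < α`. -/
theorem lintegral_min_sq_norm_lt_top (hα : α ∈ Ioo (1 : ℝ) 2) (hν : IsStableLevyMeasure α ν) :
    ∫⁻ u, ENNReal.ofReal (min (‖u‖ ^ 2) ‖u‖) ∂ν < ⊤ := by
  obtain ⟨h1, h2⟩ := hα
  have := hν.isFiniteMeasure_sphericalPart
  rw [lintegral_levyMeasure (by linarith) hν (by fun_prop)]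
  have hint : IntegrableOn (fun r : ℝ => r ^ (-(α + 1)) * min (r ^ 2) r) (Ioi 0) := by
    rw [← Ioc_union_Ioi_eq_Ioi zero_le_one]
    refine IntegrableOn.union ?_ ?_
    · have hi : IntegrableOn (fun r : ℝ => r ^ (1 - α)) (Ioc 0 1) :=
        (intervalIntegrable_iff_integrableOn_Ioc_of_le zero_le_one).1
          (intervalIntegral.intervalIntegrable_rpow' (by linarith))
      refine hi.congr_fun (fun r hr => ?_) measurableSet_Ioc
      dsimp only
      rw [min_eq_left (by nlinarith [hr.1, hr.2]), ← Real.rpow_natCast, ← Real.rpow_add hr.1]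
      congr 1
      push_cast; ring
    · have hi : IntegrableOn (fun r : ℝ => r ^ (-α)) (Ioi 1) :=
        integrableOn_Ioi_rpow_of_lt (by linarith) one_pos
      refine hi.congr_fun (fun r (hr : 1 < r) => ?_) measurableSet_Ioi
      dsimp only
      rw [min_eq_right (by nlinarith), ← Real.rpow_add_one (by linarith)]
      congr 1
      ring
  have hle : ∀ y : S d, ∫⁻ r in Ioi (0 : ℝ), ENNReal.ofReal (r ^ (-(α + 1))) *
      ENNReal.ofReal (min (‖r • (y : E d)‖ ^ 2) ‖r • (y : E d)‖)
      = ∫⁻ r in Ioi (0 : ℝ), ENNReal.ofReal (r ^ (-(α + 1)) * min (r ^ 2) r) := by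
    intro y
    refine setLIntegral_congr_fun measurableSet_Ioi fun r (hr : 0 < r) => ?_
    have hy : ‖(y : E d)‖ = 1 := by simp
    rw [norm_smul, hy, mul_one, Real.norm_eq_abs, abs_of_pos hr,
      ENNReal.ofReal_mul (by positivity)]
  simp_rw [hle]
  rw [lintegral_const]
  refine ENNReal.mul_lt_top ?_ (measure_lt_top _ _)
  exact hint.lintegral_lt_top

theorem integrable_levyExponent (hα : α ∈ Ioo (1 : ℝ) 2) (hν : IsStableLevyMeasure α ν)
    (ξ : E d) : Integrable (fun u => Complex.exp (Complex.I * (inner ℝ u ξ : ℝ)) - 1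
      - Complex.I * (inner ℝ ξ u : ℝ)) ν := by
  have hb : Integrable (fun u : E d => 2 * (1 + ‖ξ‖) ^ 2 * min (‖u‖ ^ 2) ‖u‖) ν := by
    refine Integrable.const_mul ⟨by fun_prop, ?_⟩ _
    rw [hasFiniteIntegral_iff_ofReal (Eventually.of_forall fun u => by positivity)]
    exact lintegral_min_sq_norm_lt_top hα hν
  refine hb.mono' (by fun_prop) (Eventually.of_forall fun u => ?_)
  rw [real_inner_comm]
  refine (norm_exp_I_mul_sub_one_sub_le _).trans ?_
  have h1 : |inner ℝ ξ u| ≤ ‖ξ‖ * ‖u‖ := abs_real_inner_le_norm ξ u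
  have hξ := norm_nonneg ξ
  have hu := norm_nonneg u
  rw [mul_assoc]
  refine mul_le_mul_of_nonneg_left ?_ zero_le_two
  rw [mul_min_of_nonneg _ _ (by positivity)]
  refine min_le_min ?_ ?_
  · rw [← sq_abs, ← mul_pow]
    refine pow_le_pow_left₀ (abs_nonneg _) (h1.trans ?_) 2
    gcongr
    linarith
  · refine h1.trans (mul_le_mul_of_nonneg_right ?_ hu)
    nlinarith

/-- The integral `∫ |⟨y ; ξ⟩| ^ α λ₁(dy)`, that is `σ_α(ξ) ^ α`. -/
noncomputable def spectralIntegral (α : ℝ) (ν : Measure (E d)) (ξ : E d) : ℝ :=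
  ∫ y : S d, |inner ℝ (y : E d) ξ| ^ α ∂(spectralMeasure α ν)

theorem spectralIntegral_nonneg (ξ : E d) : 0 ≤ spectralIntegral α ν ξ :=
  integral_nonneg fun y => by positivity

theorem sigmaNorm_eq (ξ : E d) : sigmaNorm α ν ξ = spectralIntegral α ν ξ ^ (1 / α) := rfl

theorem spectralIntegral_smul (r : ℝ) (ξ : E d) :
    spectralIntegral α ν (r • ξ) = |r| ^ α * spectralIntegral α ν ξ := by
  rw [spectralIntegral, spectralIntegral, ← integral_const_mul]
  refine integral_congr_ae (Eventually.of_forall fun y => ?_)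
  simp only [inner_smul_right]
  rw [abs_mul, Real.mul_rpow (abs_nonneg _) (abs_nonneg _)]

theorem spectralIntegral_neg (ξ : E d) : spectralIntegral α ν (-ξ) = spectralIntegral α ν ξ := by
  have := spectralIntegral_smul (α := α) (ν := ν) (-1) ξ
  simpa using this

/-- The normalization of the spectral measure, through Euler's reflection formula. -/
theorem spectralConst_eq (hα : α ∈ Ioo (1 : ℝ) 2) :
    -Real.cos (α * (Real.pi / 2)) * (Real.Gamma (2 - α) / (α * (α - 1)))
      = Real.pi / (2 * Real.sin (Real.pi * (α / 2)) * Real.Gamma (α + 1)) := by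
  obtain ⟨h1, h2⟩ := hα
  have hG : Real.Gamma (α + 1) = α * ((α - 1) * Real.Gamma (α - 1)) := by
    rw [Real.Gamma_add_one (by linarith)]
    congr 1
    have := Real.Gamma_add_one (s := α - 1) (by linarith)
    rwa [sub_add_cancel] at this
  have hrefl := Real.Gamma_mul_Gamma_one_sub (α - 1)
  have e1 : 1 - (α - 1) = 2 - α := by ring
  have e2 : Real.sin (Real.pi * (α - 1)) = -(2 * Real.sin (Real.pi * (α / 2)) *
      Real.cos (Real.pi * (α / 2))) := by
    rw [← Real.sin_two_mul, show Real.pi * (α - 1) = 2 * (Real.pi * (α / 2)) - Real.pi by ring,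
      Real.sin_sub_pi]
  have e3 : α * (Real.pi / 2) = Real.pi * (α / 2) := by ring
  have hs : 0 < Real.sin (Real.pi * (α / 2)) :=
    Real.sin_pos_of_pos_of_lt_pi (by positivity) (by nlinarith [Real.pi_pos])
  have hc : Real.cos (Real.pi * (α / 2)) < 0 :=
    Real.cos_neg_of_pi_div_two_lt_of_lt (by nlinarith [Real.pi_pos]) (by nlinarith [Real.pi_pos])
  have hG1 : 0 < Real.Gamma (α - 1) := Real.Gamma_pos_of_pos (by linarith)
  rw [e1, e2] at hrefl
  have hG2 : Real.Gamma (2 - α) = Real.pi / -(2 * Real.sin (Real.pi * (α / 2)) *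
      Real.cos (Real.pi * (α / 2))) / Real.Gamma (α - 1) := by
    rw [eq_div_iff hG1.ne', mul_comm]; exact hrefl
  rw [hG, hG2, e3]
  have hα1 : α - 1 ≠ 0 := by linarith
  have hc' := hc.ne
  set c := Real.cos (Real.pi * (α / 2))
  set s := Real.sin (Real.pi * (α / 2))
  field_simp

theorem integrable_spectral (hα : 0 < α) (hν : IsStableLevyMeasure α ν) (ξ : E d) :
    Integrable (fun y : S d => |inner ℝ (y : E d) ξ| ^ α) (spectralMeasure α ν) := by
  have := hν.isFiniteMeasure_spectralMeasure
  refine Integrable.of_bound (by fun_prop (disch := exact hα.le)) (‖ξ‖ ^ α)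
    (Eventually.of_forall fun y => ?_)
  have hy : ‖(y : E d)‖ = 1 := by simp
  rw [Real.norm_eq_abs, abs_of_nonneg (by positivity)]
  refine Real.rpow_le_rpow (abs_nonneg _) ((abs_real_inner_le_norm _ _).trans ?_) hα.le
  rw [hy, one_mul]

theorem lintegral_one_sub_cos_levyMeasure (hα : α ∈ Ioo (1 : ℝ) 2) (hν : IsStableLevyMeasure α ν)
    (ξ : E d) : ∫⁻ u, ENNReal.ofReal (1 - Real.cos (inner ℝ u ξ)) ∂ν
      = ENNReal.ofReal (spectralIntegral α ν ξ) := by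
  have h0 : 0 < α := by linarith [hα.1]
  rw [lintegral_levyMeasure h0 hν (by fun_prop), spectralIntegral,
    ofReal_integral_eq_lintegral_ofReal (integrable_spectral h0 hν ξ)
      (Eventually.of_forall fun y => by positivity), spectralMeasure, lintegral_smul_measure,
    spectralConst_eq hα, smul_eq_mul, ← lintegral_const_mul _ (by fun_prop)]
  refine lintegral_congr fun y => ?_
  set a : ℝ := inner ℝ (y : E d) ξ with ha
  have e1 : ∀ r : ℝ, ENNReal.ofReal (r ^ (-(α + 1))) *
      ENNReal.ofReal (1 - Real.cos (inner ℝ (r • (y : E d)) ξ))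
      = ENNReal.ofReal ((1 - Real.cos (|a| * r)) * r ^ (-(α + 1))) := by
    intro r
    rw [ENNReal.ofReal_mul (by linarith [Real.cos_le_one (|a| * r)]), mul_comm,
      real_inner_smul_left, ← Real.cos_abs (|a| * r), ← Real.cos_abs (r * inner ℝ (y : E d) ξ),
      abs_mul r, abs_mul |a|, abs_abs, mul_comm |r|]
  simp_rw [e1]
  rcases eq_or_ne a 0 with h | h
  · simp [h, Real.zero_rpow h0.ne']
  · rw [lintegral_one_sub_cos_mul_rpow h0 hα.2 (abs_pos.2 h), ENNReal.ofReal_mul (by positivity),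
      mul_comm]

/-- By symmetry, the Lévy exponent is real; its value is `-σ_α ^ α`. -/
theorem levyExponent_eq (hα : α ∈ Ioo (1 : ℝ) 2) (hν : IsStableLevyMeasure α ν)
    (hsymm : IsSymmetric α ν) (ξ : E d) :
    ∫ u, (Complex.exp (Complex.I * (inner ℝ u ξ : ℝ)) - 1 - Complex.I * (inner ℝ ξ u : ℝ)) ∂ν
      = ((-spectralIntegral α ν ξ : ℝ) : ℂ) := by
  have h0 : 0 < α := by linarith [hα.1]
  -- Adding the values at `u` and `-u` cancels the odd imaginary part of the integrand.
  set h : E d → ℂ := fun u => Complex.exp (Complex.I * (inner ℝ u ξ : ℝ)) - 1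
    - Complex.I * (inner ℝ ξ u : ℝ) with hh
  have hi : Integrable h ν := integrable_levyExponent hα hν ξ
  have hmp : MeasurePreserving (fun u : E d => -u) ν ν :=
    ⟨measurable_neg, map_neg_levyMeasure h0 hν hsymm⟩
  have hneg : ∫ u, h (-u) ∂ν = ∫ u, h u ∂ν :=
    hmp.integral_comp (MeasurableEquiv.neg (E d)).measurableEmbedding h
  have hi' : Integrable (fun u => h (-u)) ν := hmp.integrable_comp_of_integrable hi
  have hsum : ∀ u, h u + h (-u) = ((-(2 * (1 - Real.cos (inner ℝ u ξ))) : ℝ) : ℂ) := by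
    intro u
    simp only [hh, inner_neg_left, inner_neg_right]
    push_cast
    rw [Complex.cos, real_inner_comm]
    ring_nf
  have h2 : ∫ u, h u ∂ν + ∫ u, h u ∂ν = ((-(2 * spectralIntegral α ν ξ) : ℝ) : ℂ) := by
    conv_lhs => rw [← hneg]; lhs; rw [hneg]
    rw [← integral_add hi hi']
    simp_rw [hsum]
    rw [integral_complex_ofReal, integral_neg, integral_const_mul,
      integral_eq_lintegral_of_nonneg_ae
        (Eventually.of_forall fun u => by simpa using Real.cos_le_one _) (by fun_prop),
      lintegral_one_sub_cos_levyMeasure hα hν, ENNReal.toReal_ofReal (spectralIntegral_nonneg ξ)]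
  push_cast at h2 ⊢
  linear_combination h2 / 2

section Law

variable {μ : Measure (E d)}

theorem IsStableLaw.integral_exp (hα : α ∈ Ioo (1 : ℝ) 2) (hν : IsStableLevyMeasure α ν)
    (hsymm : IsSymmetric α ν) (hμ : IsStableLaw ν μ) (ξ : E d) :
    ∫ y, Complex.exp (Complex.I * (inner ℝ y ξ : ℝ)) ∂μ
      = ((Real.exp (-spectralIntegral α ν ξ) : ℝ) : ℂ) := by
  rw [hμ ξ, levyExponent_eq hα hν hsymm, Complex.ofReal_exp]

variable [IsProbabilityMeasure μ]

theorem IsStableLaw.map_neg (hα : α ∈ Ioo (1 : ℝ) 2) (hν : IsStableLevyMeasure α ν)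
    (hsymm : IsSymmetric α ν) (hμ : IsStableLaw ν μ) : μ.map (fun y => -y) = μ := by
  have : IsProbabilityMeasure (μ.map (fun y => -y)) :=
    Measure.isProbabilityMeasure_map measurable_neg.aemeasurable
  have hcf : ∀ t, charFun μ t = ((Real.exp (-spectralIntegral α ν t) : ℝ) : ℂ) := fun t => by
    rw [charFun_apply, ← hμ.integral_exp hα hν hsymm t]
    simp_rw [mul_comm]
  refine Measure.ext_of_charFun (funext fun t => ?_)
  have h1 : charFun (μ.map (fun y => -y)) t = charFun μ (-t) := by
    rw [charFun_apply, charFun_apply, integral_map measurable_neg.aemeasurable (by fun_prop)]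
    simp
  rw [h1, hcf, hcf, spectralIntegral_neg]

theorem IsStableLaw.lintegral_one_sub_cos (hα : α ∈ Ioo (1 : ℝ) 2) (hν : IsStableLevyMeasure α ν)
    (hsymm : IsSymmetric α ν) (hμ : IsStableLaw ν μ) (ξ : E d) :
    ∫⁻ y, ENNReal.ofReal (1 - Real.cos (inner ℝ y ξ)) ∂μ
      = ENNReal.ofReal (1 - Real.exp (-spectralIntegral α ν ξ)) := by
  have hi : Integrable (fun y => Complex.exp (Complex.I * (inner ℝ y ξ : ℝ))) μ :=
    Integrable.of_bound (by fun_prop) 1 (Eventually.of_forall fun y => by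
      rw [Complex.norm_exp_I_mul_ofReal])
  have hre : ∀ y, (Complex.exp (Complex.I * (inner ℝ y ξ : ℝ))).re = Real.cos (inner ℝ y ξ) :=
    fun y => by rw [mul_comm, Complex.exp_ofReal_mul_I_re]
  have hc : Integrable (fun y => Real.cos (inner ℝ y ξ)) μ := by
    simp_rw [← hre]; exact hi.re
  have hcos : ∫ y, Real.cos (inner ℝ y ξ) ∂μ = Real.exp (-spectralIntegral α ν ξ) := by
    have h1 := integral_re hi
    rw [hμ.integral_exp hα hν hsymm] at h1
    simp only [RCLike.re_to_complex, hre, Complex.ofReal_re] at h1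
    exact h1
  have hc1 : Integrable (fun y => 1 - Real.cos (inner ℝ y ξ)) μ := (integrable_const 1).sub hc
  rw [← hcos, ← ofReal_integral_eq_lintegral_ofReal hc1
    (Eventually.of_forall fun y => by simpa using Real.cos_le_one _),
    integral_sub (integrable_const 1) hc]
  simp

/-- The first absolute moments, from `|z| = (2 / π) ∫ (1 - cos (z r)) r⁻² dr` and the characteristic
function. -/
theorem IsStableLaw.lintegral_abs_inner (hα : α ∈ Ioo (1 : ℝ) 2) (hν : IsStableLevyMeasure α ν)
    (hsymm : IsSymmetric α ν) (hμ : IsStableLaw ν μ) (n : E d) :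
    ∫⁻ y, ENNReal.ofReal |inner ℝ y n| ∂μ
      = ENNReal.ofReal (2 / Real.pi * (sigmaNorm α ν n * Real.Gamma (1 - 1 / α))) := by
  have hπ := Real.pi_pos
  have hcos : ∀ z : ℝ, 0 ≤ 1 - Real.cos z := fun z => by linarith [Real.cos_le_one z]
  have key : ENNReal.ofReal (Real.pi / 2) * ∫⁻ y, ENNReal.ofReal |inner ℝ y n| ∂μ
      = ENNReal.ofReal (sigmaNorm α ν n * Real.Gamma (1 - 1 / α)) := by
    rw [← lintegral_const_mul _ (by fun_prop)]
    simp_rw [← ENNReal.ofReal_mul (by positivity : 0 ≤ Real.pi / 2),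
      ← lintegral_one_sub_cos_mul_rpow_neg_two]
    rw [lintegral_lintegral_swap (by fun_prop), sigmaNorm_eq,
      ← lintegral_one_sub_exp_mul_rpow_neg_two hα.1 (spectralIntegral_nonneg n)]
    refine setLIntegral_congr_fun measurableSet_Ioi fun r (hr : 0 < r) => ?_
    simp_rw [ENNReal.ofReal_mul (hcos _)]
    rw [lintegral_mul_const _ (by fun_prop)]
    have e : ∀ y : E d, inner ℝ y n * r = inner ℝ y (r • n) := fun y => by
      rw [real_inner_smul_right, mul_comm]
    simp_rw [e]
    rw [hμ.lintegral_one_sub_cos hα hν hsymm, spectralIntegral_smul, abs_of_pos hr,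
      mul_comm (r ^ α), ← ENNReal.ofReal_mul]
    have : 0 ≤ spectralIntegral α ν n * r ^ α :=
      mul_nonneg (spectralIntegral_nonneg n) (by positivity)
    have := Real.exp_le_one_iff.2 (neg_nonpos.2 this)
    linarith
  rw [← ENNReal.mul_right_inj (ENNReal.ofReal_pos.2 (by positivity : 0 < Real.pi / 2)).ne'
    ENNReal.ofReal_ne_top, key, ← ENNReal.ofReal_mul (by positivity)]
  congr 1
  field_simp

/-- Half of the first absolute moment, by symmetry. -/
theorem IsStableLaw.lintegral_neg_inner (hα : α ∈ Ioo (1 : ℝ) 2) (hν : IsStableLevyMeasure α ν)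
    (hsymm : IsSymmetric α ν) (hμ : IsStableLaw ν μ) (n : E d) :
    ∫⁻ y, ENNReal.ofReal (-inner ℝ y n) ∂μ
      = ENNReal.ofReal (Real.Gamma (1 - 1 / α) / Real.pi * sigmaNorm α ν n) := by
  have hswap : ∫⁻ y, ENNReal.ofReal (inner ℝ y n) ∂μ = ∫⁻ y, ENNReal.ofReal (-inner ℝ y n) ∂μ := by
    conv_lhs => rw [← hμ.map_neg hα hν hsymm]
    rw [lintegral_map (by fun_prop) measurable_neg]
    simp
  have habs := hμ.lintegral_abs_inner hα hν hsymm n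
  have e : ∀ a : ℝ, ENNReal.ofReal |a| = ENNReal.ofReal a + ENNReal.ofReal (-a) := by
    intro a
    rcases le_total 0 a with h | h
    · rw [abs_of_nonneg h, ENNReal.ofReal_of_nonpos (neg_nonpos.2 h), add_zero]
    · rw [abs_of_nonpos h, ENNReal.ofReal_of_nonpos h, zero_add]
  simp_rw [e] at habs
  rw [lintegral_add_left (by fun_prop), hswap, ← two_mul] at habs
  rw [← ENNReal.mul_right_inj two_ne_zero ENNReal.ofNat_ne_top, habs,
    ← ENNReal.ofReal_ofNat, ← ENNReal.ofReal_mul (by norm_num)]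
  congr 1
  ring

end Law

end Levy

/-! ### Randomly translated unit balls of a seminorm -/

/-- Fekete's lemma at the origin: `f s / s` converges to its supremum, which is finite thanks to
the linear bound. -/
theorem exists_tendsto_div_of_subadditive {f : ℝ → ℝ} {K : ℝ}
    (hsub : ∀ a b, 0 < a → 0 < b → f (a + b) ≤ f a + f b) (h0 : ∀ a, 0 < a → 0 ≤ f a)
    (hK : ∀ a, 0 < a → f a ≤ K * a) :
    ∃ L, 0 ≤ L ∧ Tendsto (fun s => f s / s) (𝓝[>] 0) (𝓝 L) := by
  have hK0 : 0 ≤ K := by simpa using (h0 1 one_pos).trans (hK 1 one_pos)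
  set A : Set ℝ := (fun s => f s / s) '' Ioi 0 with hA
  have hbdd : BddAbove A := by
    refine ⟨K, ?_⟩
    rintro _ ⟨s, hs, rfl⟩
    exact (div_le_iff₀ hs).2 (hK s hs)
  have hne : A.Nonempty := ⟨_, 1, mem_Ioi.2 one_pos, rfl⟩
  have hmul : ∀ (n : ℕ) (s r : ℝ), 0 < s → 0 < r → f (n * s + r) ≤ n * f s + f r := by
    intro n s r hs hr
    induction n with
    | zero => simp
    | succ n ih =>
      have e : ((n + 1 : ℕ) : ℝ) * s + r = s + (n * s + r) := by push_cast; ring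
      rw [e]
      have := hsub s (n * s + r) hs (by positivity)
      push_cast
      linarith
  -- Up to an error vanishing with `s`, every quotient bounds the quotients at small `s` from below.
  have hlow : ∀ s₀ s, 0 < s₀ → 0 < s → f s₀ / s₀ - K * s / s₀ ≤ f s / s := by
    intro s₀ s hs₀ hs
    -- `s₀ = n s + r` with `0 < r ≤ s`.
    set n : ℕ := ⌈s₀ / s⌉₊ - 1 with hn
    have hc : 1 ≤ ⌈s₀ / s⌉₊ := Nat.one_le_iff_ne_zero.2 (by simp; positivity)
    have hn1 : (n : ℝ) + 1 = ⌈s₀ / s⌉₊ := by rw [hn]; push_cast [Nat.cast_sub hc]; ring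
    have h1 : (n : ℝ) * s < s₀ := by
      have := Nat.ceil_lt_add_one (by positivity : 0 ≤ s₀ / s)
      rw [← lt_div_iff₀ hs]; linarith
    have h2 : s₀ ≤ (n + 1) * s := by
      have := Nat.le_ceil (s₀ / s)
      rw [← div_le_iff₀ hs]; linarith
    have h3 := hmul n s (s₀ - n * s) hs (by linarith)
    rw [add_sub_cancel] at h3
    have h4 := hK (s₀ - n * s) (by linarith)
    have h5 : K * (s₀ - n * s) ≤ K * s := mul_le_mul_of_nonneg_left (by linarith) hK0
    have h6 : n * f s ≤ s₀ * (f s / s) := by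
      rw [← mul_div_assoc, le_div_iff₀ hs]
      nlinarith [h0 s hs]
    rw [← sub_div, div_le_iff₀ hs₀]
    linarith
  refine ⟨sSup A, Real.sSup_nonneg ?_, tendsto_order.2 ⟨fun a ha => ?_, fun a ha => ?_⟩⟩
  · rintro _ ⟨s, hs, rfl⟩
    exact div_nonneg (h0 s hs) (le_of_lt hs)
  · obtain ⟨_, ⟨s₀, hs₀, rfl⟩, h⟩ := exists_lt_of_lt_csSup hne ha
    have hs₀' : 0 < s₀ := hs₀
    have ht : Tendsto (fun s => f s₀ / s₀ - K * s / s₀) (𝓝[>] 0) (𝓝 (f s₀ / s₀)) := by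
      have : Continuous fun s => f s₀ / s₀ - K * s / s₀ := by fun_prop
      simpa using (this.tendsto 0).mono_left nhdsWithin_le_nhds
    filter_upwards [ht.eventually_const_lt h, self_mem_nhdsWithin] with s hs hs'
    exact hs.trans_le (hlow s₀ s hs₀' hs')
  · filter_upwards [self_mem_nhdsWithin] with s hs
    exact (le_csSup hbdd ⟨s, hs, rfl⟩).trans_lt ha

theorem measurable_fderiv_apply_prod (f : E d → ℝ) :
    Measurable fun q : E d × E d => fderiv ℝ f q.2 q.1 :=
  ContinuousLinearMap.measurable_apply₂.comp
    (((measurable_fderiv ℝ f).comp measurable_snd).prodMk measurable_fst)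

section Seminorm

variable (p : Seminorm ℝ (E d))

open scoped Pointwise in
theorem volume_seminorm_le {r : ℝ} (hr : 0 < r) :
    volume {x | p x ≤ r} = ENNReal.ofReal (r ^ d) * volume {x | p x ≤ 1} := by
  have : {x | p x ≤ r} = r • {x | p x ≤ 1} := by
    ext x
    rw [mem_smul_set_iff_inv_smul_mem₀ hr.ne']
    simp only [mem_ofPred_eq, map_smul_eq_mul, norm_inv, Real.norm_eq_abs, abs_of_pos hr]
    rw [inv_mul_le_iff₀ hr, mul_one]
  rw [this, Measure.addHaar_smul_of_nonneg _ hr.le, finrank_euclideanSpace_fin]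

/-- The unit sphere of `p` lies in the frontier of the convex unit ball, hence is null. -/
theorem volume_seminorm_eq_one : volume {x | p x = 1} = 0 := by
  refine measure_mono_null ?_ ((p.convex_closedBall 0 1).addHaar_frontier volume)
  intro x hx
  have hx : p x = 1 := hx
  rw [p.closedBall_zero_eq]
  refine ⟨subset_closure hx.le, fun hi => ?_⟩
  have ht : Tendsto (fun ε : ℝ => (1 + ε) • x) (𝓝[>] 0) (𝓝 x) := by
    have : Continuous fun ε : ℝ => (1 + ε) • x := by fun_prop
    simpa using (this.tendsto 0).mono_left nhdsWithin_le_nhds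
  obtain ⟨ε, h1, h2⟩ := ((ht.eventually (mem_interior_iff_mem_nhds.1 hi)).and
    self_mem_nhdsWithin).exists
  have h2 : 0 < ε := h2
  have h1 : p ((1 + ε) • x) ≤ 1 := h1
  rw [map_smul_eq_mul, hx, mul_one, Real.norm_eq_abs, abs_of_pos (by linarith)] at h1
  linarith

/-- The volume of the part of the unit ball of `p` that leaves the ball under translation by
`-h`. -/
noncomputable def exitVolume (h : E d) : ENNReal := volume {x | p x ≤ 1 ∧ 1 < p (x - h)}

theorem exitVolume_add_le (a b : E d) :
    exitVolume p (a + b) ≤ exitVolume p a + exitVolume p b := by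
  have hb : exitVolume p b = volume ((fun x => x - a) ⁻¹' {x | p x ≤ 1 ∧ 1 < p (x - b)}) := by
    simp_rw [sub_eq_add_neg _ a]
    rw [measure_preimage_add_right]; rfl
  rw [hb]
  refine (measure_mono fun x hx => ?_).trans (measure_union_le _ _)
  obtain ⟨h1, h2⟩ := hx
  rcases le_or_gt (p (x - a)) 1 with h | h
  · exact Or.inr ⟨h, by rwa [sub_sub]⟩
  · exact Or.inl ⟨h1, h⟩

/-- A point of the ball leaving it lies in the shell `1 - p h < p x ≤ 1`. -/
theorem exitVolume_le (hd : 1 ≤ d) (hp : Continuous p) (hfin : volume {x | p x ≤ 1} ≠ ⊤) (h : E d) :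
    exitVolume p h ≤ ENNReal.ofReal (d * p h) * volume {x | p x ≤ 1} := by
  have hd' : (1 : ℝ) ≤ d := by exact_mod_cast hd
  rcases lt_or_ge (p h) 1 with h1 | h1
  · have hr : 0 < 1 - p h := by linarith
    have hsub : {x | p x ≤ 1 ∧ 1 < p (x - h)} ⊆ {x | p x ≤ 1} \ {x | p x ≤ 1 - p h} := by
      rintro x ⟨hx1, hx2⟩
      refine ⟨hx1, fun hx3 : p x ≤ 1 - p h => ?_⟩
      have := map_sub_le_add p x h
      linarith
    refine (measure_mono hsub).trans ?_
    have hm : MeasurableSet {x | p x ≤ 1 - p h} := measurableSet_le hp.measurable measurable_const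
    have hle : {x | p x ≤ 1 - p h} ⊆ {x | p x ≤ 1} := fun x (hx : p x ≤ 1 - p h) =>
      hx.trans (by linarith [apply_nonneg p h])
    rw [measure_sdiff hle hm.nullMeasurableSet (ne_top_of_le_ne_top hfin (measure_mono hle)),
      volume_seminorm_le p hr, tsub_le_iff_right, ← add_mul,
      ← ENNReal.ofReal_add (mul_nonneg (by positivity) (apply_nonneg p h)) (by positivity)]
    refine le_mul_of_one_le_left zero_le ?_
    rw [ENNReal.one_le_ofReal]
    -- Bernoulli's inequality
    have := one_add_mul_le_pow (a := -p h) (by linarith) d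
    rw [← sub_eq_add_neg] at this
    linarith
  · refine (measure_mono fun x hx => hx.1).trans (le_mul_of_one_le_left zero_le ?_)
    rw [ENNReal.one_le_ofReal]
    nlinarith

open scoped Pointwise in
theorem ofReal_pow_mul_exitVolume {r : ℝ} (hr : 0 < r) (h : E d) :
    ENNReal.ofReal (r ^ d) * exitVolume p (r⁻¹ • h) = volume {x | p x ≤ r ∧ r < p (x - h)} := by
  have : {x | p x ≤ r ∧ r < p (x - h)} = r • {x | p x ≤ 1 ∧ 1 < p (x - r⁻¹ • h)} := by
    ext x
    rw [mem_smul_set_iff_inv_smul_mem₀ hr.ne']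
    simp only [mem_ofPred_eq, ← smul_sub, map_smul_eq_mul, norm_inv, Real.norm_eq_abs,
      abs_of_pos hr]
    rw [inv_mul_le_iff₀ hr, mul_one, lt_inv_mul_iff₀ hr, mul_one]
  rw [this, Measure.addHaar_smul_of_nonneg _ hr.le, finrank_euclideanSpace_fin]
  rfl

variable (μ : Measure (E d))

theorem measurable_exitVolume (hp : Continuous p) : Measurable (exitVolume p) := by
  have h : MeasurableSet {q : E d × E d | p q.2 ≤ 1 ∧ 1 < p (q.2 - q.1)} :=
    (measurableSet_le (hp.measurable.comp measurable_snd) measurable_const).inter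
      (measurableSet_lt measurable_const
        (hp.measurable.comp (measurable_snd.sub measurable_fst)))
  exact measurable_measure_prodMk_left h

/-- Averaging `exitVolume` over the dilates of the unit ball turns it into an integral of increments
of `p`: a point `x` contributes the measure of the levels `r` between `p x` and `p (x - h)`. -/
theorem lintegral_pow_mul_exitVolume (hp : Continuous p) (h : E d) :
    ∫⁻ r in Ioo (0 : ℝ) 1, ENNReal.ofReal (r ^ d) * exitVolume p (r⁻¹ • h)
      = ∫⁻ x, ENNReal.ofReal (min (p (x - h)) 1 - p x) := by
  have hpm := hp.measurable
  have hpm' : Measurable fun x => p (x - h) := hpm.comp (measurable_id.sub_const h)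
  have hm : MeasurableSet {q : ℝ × E d | p q.2 ≤ q.1 ∧ q.1 < p (q.2 - h)} :=
    (measurableSet_le (hpm.comp measurable_snd) measurable_fst).inter
      (measurableSet_lt measurable_fst (hpm'.comp measurable_snd))
  calc ∫⁻ r in Ioo (0 : ℝ) 1, ENNReal.ofReal (r ^ d) * exitVolume p (r⁻¹ • h)
      = ∫⁻ r in Ioo (0 : ℝ) 1, ∫⁻ x,
          {q : ℝ × E d | p q.2 ≤ q.1 ∧ q.1 < p (q.2 - h)}.indicator 1 (r, x) := by
        refine setLIntegral_congr_fun measurableSet_Ioo fun r hr => ?_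
        have hmr : MeasurableSet {x | p x ≤ r ∧ r < p (x - h)} := measurable_prodMk_left hm
        rw [ofReal_pow_mul_exitVolume p hr.1, ← lintegral_indicator_one hmr]
        rfl
    _ = ∫⁻ x, ∫⁻ r in Ioo (0 : ℝ) 1,
          {q : ℝ × E d | p q.2 ≤ q.1 ∧ q.1 < p (q.2 - h)}.indicator 1 (r, x) :=
        lintegral_lintegral_swap ((measurable_const.indicator hm).aemeasurable)
    _ = _ := by
        refine lintegral_congr fun x => ?_
        have hi : ∀ r, {q : ℝ × E d | p q.2 ≤ q.1 ∧ q.1 < p (q.2 - h)}.indicator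
            (1 : ℝ × E d → ENNReal) (r, x) = (Ico (p x) (p (x - h))).indicator 1 r := fun r => rfl
        simp_rw [hi]
        rw [lintegral_indicator_one measurableSet_Ico, Measure.restrict_apply measurableSet_Ico,
          measure_congr ((ae_eq_refl _).inter Ioo_ae_eq_Ico), Ico_inter_Ico, Real.volume_Ico,
          sup_of_le_left (apply_nonneg p x)]

/-- Differentiating the averaged increments of `p` under the integral sign is legitimate since the
Lipschitz function `p` is differentiable almost everywhere. -/
theorem tendsto_lintegral_increment [IsProbabilityMeasure μ] {M : NNReal} (hlip : LipschitzWith M p)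
    (hfin : volume {x | p x ≤ 1} ≠ ⊤) (hμ : ∫⁻ y, ENNReal.ofReal (p y) ∂μ ≠ ⊤) :
    Tendsto (fun s : ℝ => ENNReal.ofReal s⁻¹ * ∫⁻ y, ∫⁻ x,
        ENNReal.ofReal (min (p (x - s • y)) 1 - p x) ∂volume ∂μ) (𝓝[>] 0)
      (𝓝 (∫⁻ x in {x | p x ≤ 1}, ∫⁻ y, ENNReal.ofReal (-(fderiv ℝ p x y)) ∂μ)) := by
  have hp := hlip.continuous
  have hpm := hp.measurable
  set C : Set (E d) := {x | p x ≤ 1} with hC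
  have hCm : MeasurableSet C := measurableSet_le hpm measurable_const
  have : IsFiniteMeasure (volume.restrict C) := ⟨by simpa using hfin.lt_top⟩
  have hjm : ∀ s : ℝ, Measurable fun q : E d × E d => min (p (q.2 - s • q.1)) 1 - p q.2 := fun s =>
    ((hpm.comp (by fun_prop : Measurable fun q : E d × E d => q.2 - s • q.1)).min
      measurable_const).sub (hpm.comp measurable_snd)
  have hmd : Measurable fun q : E d × E d => ENNReal.ofReal (-(fderiv ℝ p q.2 q.1)) :=
    (measurable_fderiv_apply_prod p).neg.ennreal_ofReal
  have hlim : Tendsto (fun s : ℝ => ∫⁻ q, ENNReal.ofReal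
        ((min (p (q.2 - s • q.1)) 1 - p q.2) / s) ∂(μ.prod (volume.restrict C))) (𝓝[>] 0)
      (𝓝 (∫⁻ q, ENNReal.ofReal (-(fderiv ℝ p q.2 q.1)) ∂(μ.prod (volume.restrict C)))) := by
    have hB : ∫⁻ q : E d × E d, ENNReal.ofReal (p q.1) ∂(μ.prod (volume.restrict C)) ≠ ⊤ := by
      rw [lintegral_prod _ (by fun_prop)]
      simp only [lintegral_const]
      rw [lintegral_mul_const _ (by fun_prop)]
      exact ENNReal.mul_ne_top hμ (measure_ne_top _ _)
    apply tendsto_lintegral_filter_of_dominated_convergence _ _ _ hB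
    rotate_left
    · exact Eventually.of_forall fun s => ((hjm s).div_const s).ennreal_ofReal
    · filter_upwards [self_mem_nhdsWithin] with s (hs : 0 < s)
      filter_upwards with q
      apply ENNReal.ofReal_le_ofReal
      rw [div_le_iff₀ hs]
      have h1 := map_sub_le_add p q.2 (s • q.1)
      rw [map_smul_eq_mul, Real.norm_eq_abs, abs_of_pos hs] at h1
      have := min_le_left (p (q.2 - s • q.1)) 1
      linarith
    · have hae : ∀ᵐ x ∂(volume.restrict C), DifferentiableAt ℝ p x ∧ p x < 1 := by
        refine (ae_restrict_of_ae hlip.ae_differentiableAt).and ?_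
        have h1 : ∀ᵐ x : E d, p x ≠ 1 := by
          rw [ae_iff]; simpa using volume_seminorm_eq_one p
        filter_upwards [ae_restrict_of_ae h1, ae_restrict_mem hCm] with x hx hx'
        exact lt_of_le_of_ne hx' hx
      filter_upwards [Measure.quasiMeasurePreserving_snd.ae hae] with q ⟨hdiff, hlt⟩
      apply ENNReal.tendsto_ofReal
      have hl := (hdiff.hasFDerivAt.hasLineDerivAt (-q.1)).tendsto_slope_zero_right
      rw [map_neg] at hl
      refine hl.congr' ?_
      have hc : Tendsto (fun s : ℝ => p (q.2 - s • q.1)) (𝓝[>] 0) (𝓝 (p q.2)) := by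
        have : Continuous fun s : ℝ => p (q.2 - s • q.1) := hp.comp (by fun_prop)
        simpa using (this.tendsto 0).mono_left nhdsWithin_le_nhds
      filter_upwards [hc.eventually_lt_const hlt] with s hs
      rw [min_eq_left hs.le, smul_eq_mul, inv_mul_eq_div, smul_neg, ← sub_eq_add_neg]
  have hR : ∫⁻ q, ENNReal.ofReal (-(fderiv ℝ p q.2 q.1)) ∂(μ.prod (volume.restrict C))
      = ∫⁻ x in C, ∫⁻ y, ENNReal.ofReal (-(fderiv ℝ p x y)) ∂μ :=
    lintegral_prod_symm _ hmd.aemeasurable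
  rw [hR] at hlim
  refine hlim.congr' ?_
  filter_upwards [self_mem_nhdsWithin] with s (hs : 0 < s)
  rw [lintegral_prod _ ((hjm s).div_const s).ennreal_ofReal.aemeasurable,
    ← lintegral_const_mul _ ((hjm s).ennreal_ofReal.lintegral_prod_right')]
  refine lintegral_congr fun y => ?_
  have hmy : Measurable fun x => ENNReal.ofReal (min (p (x - s • y)) 1 - p x) :=
    (((hpm.comp (measurable_id.sub_const (s • y))).min measurable_const).sub hpm).ennreal_ofReal
  rw [← lintegral_const_mul _ hmy, ← lintegral_indicator hCm]
  refine lintegral_congr fun x => ?_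
  rw [← ENNReal.ofReal_mul (by positivity), inv_mul_eq_div]
  by_cases hx : x ∈ C
  · rw [indicator_of_mem hx]
  · rw [indicator_of_notMem hx, ENNReal.ofReal_of_nonpos]
    have h1 : 1 < p x := not_le.1 hx
    exact div_nonpos_of_nonpos_of_nonneg (by linarith [min_le_right (p (x - s • y)) 1]) hs.le

/-- First-order asymptotics of the randomly translated unit ball of `p`. The limit exists by
subadditivity; its value is found by averaging over the dilates of the ball. -/
theorem tendsto_lintegral_exitVolume_div [IsProbabilityMeasure μ] (hd : 1 ≤ d) {M : NNReal}
    (hlip : LipschitzWith M p)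
    (hfin : volume {x | p x ≤ 1} ≠ ⊤) (hμ : ∫⁻ y, ENNReal.ofReal (p y) ∂μ ≠ ⊤) :
    Tendsto (fun s : ℝ => (∫⁻ y, exitVolume p (s • y) ∂μ).toReal / s) (𝓝[>] 0)
      (𝓝 (d * (∫⁻ x in {x | p x ≤ 1}, ∫⁻ y, ENNReal.ofReal (-(fderiv ℝ p x y)) ∂μ).toReal)) := by
  have hp := hlip.continuous
  have hem := measurable_exitVolume p hp
  have hd0 : (0 : ℝ) < d := by exact_mod_cast hd
  set V : ENNReal := volume {x | p x ≤ 1} with hV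
  set G : ℝ → ENNReal := fun s => ∫⁻ y, exitVolume p (s • y) ∂μ with hG
  have hGm : Measurable G := by
    have : Measurable fun q : ℝ × E d => exitVolume p (q.1 • q.2) := hem.comp (by fun_prop)
    exact this.lintegral_prod_right'
  set K : ENNReal := ENNReal.ofReal d * (∫⁻ y, ENNReal.ofReal (p y) ∂μ) * V with hKdef
  have hKfin : K ≠ ⊤ := ENNReal.mul_ne_top (ENNReal.mul_ne_top ENNReal.ofReal_ne_top hμ) hfin
  have hGle : ∀ s, 0 < s → G s ≤ ENNReal.ofReal s * K := by
    intro s hs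
    calc G s ≤ ∫⁻ y, ENNReal.ofReal s * (ENNReal.ofReal d * ENNReal.ofReal (p y) * V) ∂μ := by
          refine lintegral_mono fun y => (exitVolume_le p hd hp hfin _).trans_eq ?_
          rw [map_smul_eq_mul, Real.norm_eq_abs, abs_of_pos hs, ENNReal.ofReal_mul hd0.le,
            ENNReal.ofReal_mul hs.le]
          ring
      _ = _ := by
          have hm : Measurable fun y => ENNReal.ofReal (p y) := hp.measurable.ennreal_ofReal
          rw [lintegral_const_mul _ ((hm.const_mul _).mul_const _),
            lintegral_mul_const _ (hm.const_mul _), lintegral_const_mul _ hm]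
  have hGfin : ∀ s, 0 < s → G s ≠ ⊤ := fun s hs =>
    ne_top_of_le_ne_top (ENNReal.mul_ne_top ENNReal.ofReal_ne_top hKfin) (hGle s hs)
  have hgle : ∀ s, 0 < s → (G s).toReal ≤ K.toReal * s := fun s hs => by
    have := ENNReal.toReal_mono (ENNReal.mul_ne_top ENNReal.ofReal_ne_top hKfin) (hGle s hs)
    rwa [ENNReal.toReal_mul, ENNReal.toReal_ofReal hs.le, mul_comm] at this
  obtain ⟨L, hL0, hL⟩ := exists_tendsto_div_of_subadditive (f := fun s => (G s).toReal)
    (K := K.toReal) (fun a b ha hb => by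
      rw [← ENNReal.toReal_add (hGfin a ha) (hGfin b hb)]
      refine ENNReal.toReal_mono (ENNReal.add_ne_top.2 ⟨hGfin a ha, hGfin b hb⟩) ?_
      simp only [hG]
      have hma : Measurable fun y : E d => exitVolume p (a • y) := hem.comp (by fun_prop)
      rw [← lintegral_add_left hma]
      refine lintegral_mono fun y => ?_
      rw [add_smul]
      exact exitVolume_add_le p _ _)
    (fun a _ => ENNReal.toReal_nonneg) hgle
  have h1 : Tendsto (fun s : ℝ => ∫⁻ r in Ioo (0 : ℝ) 1,
      ENNReal.ofReal (r ^ (d - 1) * ((G (s * r⁻¹)).toReal / (s * r⁻¹)))) (𝓝[>] 0)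
      (𝓝 (∫⁻ r in Ioo (0 : ℝ) 1, ENNReal.ofReal (r ^ (d - 1) * L))) := by
    refine tendsto_lintegral_filter_of_dominated_convergence
      (fun _ => ENNReal.ofReal K.toReal) (Eventually.of_forall fun s => ?_) ?_ ?_ ?_
    · have : Measurable fun r : ℝ => (G (s * r⁻¹)).toReal :=
        (hGm.comp (by fun_prop : Measurable fun r : ℝ => s * r⁻¹)).ennreal_toReal
      fun_prop
    · filter_upwards [self_mem_nhdsWithin] with s (hs : 0 < s)
      filter_upwards [ae_restrict_mem measurableSet_Ioo] with r hr
      refine ENNReal.ofReal_le_ofReal ?_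
      have hsr : 0 < s * r⁻¹ := mul_pos hs (inv_pos.2 hr.1)
      have h2 : (G (s * r⁻¹)).toReal / (s * r⁻¹) ≤ K.toReal := (div_le_iff₀ hsr).2 (hgle _ hsr)
      have h3 : r ^ (d - 1) ≤ 1 := pow_le_one₀ hr.1.le hr.2.le
      have h4 : 0 ≤ r ^ (d - 1) := pow_nonneg hr.1.le _
      have h5 : 0 ≤ (G (s * r⁻¹)).toReal / (s * r⁻¹) := by positivity
      nlinarith
    · simp
    · filter_upwards [ae_restrict_mem measurableSet_Ioo] with r hr
      refine ENNReal.tendsto_ofReal (Tendsto.const_mul _ (hL.comp ?_))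
      refine tendsto_nhdsWithin_iff.2 ⟨?_, ?_⟩
      · have : Continuous fun s : ℝ => s * r⁻¹ := by fun_prop
        simpa using (this.tendsto 0).mono_left nhdsWithin_le_nhds
      · filter_upwards [self_mem_nhdsWithin] with s (hs : 0 < s)
        exact mul_pos hs (inv_pos.2 hr.1)
  have h2 := tendsto_lintegral_increment p μ hlip hfin hμ
  have h3 : ∀ᶠ s in 𝓝[>] (0 : ℝ), (∫⁻ r in Ioo (0 : ℝ) 1,
      ENNReal.ofReal (r ^ (d - 1) * ((G (s * r⁻¹)).toReal / (s * r⁻¹))))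
      = ENNReal.ofReal s⁻¹ * ∫⁻ y, ∫⁻ x,
        ENNReal.ofReal (min (p (x - s • y)) 1 - p x) ∂volume ∂μ := by
    filter_upwards [self_mem_nhdsWithin] with s (hs : 0 < s)
    have hms : Measurable fun q : E d × ℝ =>
        ENNReal.ofReal (q.2 ^ d) * exitVolume p (q.2⁻¹ • s • q.1) :=
      (by fun_prop : Measurable fun q : E d × ℝ => ENNReal.ofReal (q.2 ^ d)).mul
        (hem.comp (by fun_prop))
    simp_rw [← lintegral_pow_mul_exitVolume p hp]
    rw [lintegral_lintegral_swap hms.aemeasurable, ← lintegral_const_mul _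
      hms.lintegral_prod_left']
    refine setLIntegral_congr_fun measurableSet_Ioo fun r hr => ?_
    have hr0 : 0 < r := hr.1
    have hsr : 0 < s * r⁻¹ := mul_pos hs (inv_pos.2 hr.1)
    have hmr : Measurable fun y : E d => exitVolume p (r⁻¹ • s • y) := hem.comp (by fun_prop)
    dsimp only
    rw [lintegral_const_mul _ hmr]
    have e : ∫⁻ y, exitVolume p (r⁻¹ • s • y) ∂μ = G (s * r⁻¹) := by
      simp only [hG, smul_smul, mul_comm]
    rw [e, ← mul_assoc, ← ENNReal.ofReal_mul (by positivity), ← ENNReal.ofReal_toReal (hGfin _ hsr),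
      ← ENNReal.ofReal_mul (by positivity), ENNReal.toReal_ofReal ENNReal.toReal_nonneg]
    congr 1
    obtain ⟨k, rfl⟩ : ∃ k, d = k + 1 := ⟨d - 1, by omega⟩
    rw [Nat.add_sub_cancel]
    field_simp
    ring
  have h4 := tendsto_nhds_unique (h1.congr' h3) h2
  have h5 : ∫⁻ r in Ioo (0 : ℝ) 1, ENNReal.ofReal (r ^ (d - 1) * L) = ENNReal.ofReal (L / d) := by
    have hi : IntegrableOn (fun r : ℝ => r ^ (d - 1) * L) (Ioc 0 1) :=
      (Continuous.integrableOn_Icc (by fun_prop)).mono_set Ioc_subset_Icc_self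
    rw [setLIntegral_congr Ioo_ae_eq_Ioc, ← ofReal_integral_eq_lintegral_ofReal hi,
      ← intervalIntegral.integral_of_le zero_le_one, intervalIntegral.integral_mul_const,
      integral_pow, Nat.sub_add_cancel hd, one_pow, zero_pow (by omega)]
    · congr 1
      push_cast [Nat.cast_sub hd]
      ring
    · filter_upwards [ae_restrict_mem measurableSet_Ioc] with r hr
      have := hr.1
      positivity
  rw [← h4, h5, ENNReal.toReal_ofReal (by positivity), mul_div_cancel₀ _ hd0.ne']
  exact hL

end Seminorm

/-! ### Divergence integrals over the unit ball of a seminorm -/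

/-- The continuous piecewise affine function of `t` equal to `1` for `t ≤ 1` and to `0` for
`1 + ε ≤ t`. -/
noncomputable def affineCutoff (ε t : ℝ) : ℝ := max 0 (min 1 (1 - (t - 1) / ε))

theorem lipschitzWith_affineCutoff {ε : ℝ} (hε : 0 < ε) :
    LipschitzWith (Real.toNNReal ε⁻¹) (affineCutoff ε) := by
  refine ((LipschitzWith.of_dist_le_mul fun x y => ?_).const_min 1).const_max 0
  rw [Real.dist_eq, Real.dist_eq, Real.coe_toNNReal _ (by positivity)]
  have : 1 - (x - 1) / ε - (1 - (y - 1) / ε) = -(ε⁻¹ * (x - y)) := by field_simp; ring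
  rw [this, abs_neg, abs_mul, abs_of_pos (inv_pos.2 hε)]

theorem affineCutoff_of_le {ε t : ℝ} (hε : 0 < ε) (ht : t ≤ 1) : affineCutoff ε t = 1 := by
  have : (t - 1) / ε ≤ 0 := div_nonpos_of_nonpos_of_nonneg (by linarith) hε.le
  rw [affineCutoff, min_eq_left (by linarith), max_eq_right zero_le_one]

theorem affineCutoff_of_ge {ε t : ℝ} (hε : 0 < ε) (ht : 1 + ε ≤ t) : affineCutoff ε t = 0 := by
  have : 1 ≤ (t - 1) / ε := (le_div_iff₀ hε).2 (by linarith)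
  rw [affineCutoff]
  exact max_eq_left ((min_le_right _ _).trans (by linarith))

theorem abs_affineCutoff_le (ε t : ℝ) : |affineCutoff ε t| ≤ 1 := by
  rw [affineCutoff, abs_of_nonneg (le_max_left _ _)]
  exact max_le zero_le_one (min_le_left _ _)

theorem continuous_divergence {φ : E d → E d} (hφ : ContDiff ℝ 1 φ) :
    Continuous (divergence φ) := by
  refine continuous_finsetSum _ fun i _ => ?_
  have h : Continuous fun x => fderiv ℝ φ x (EuclideanSpace.single i 1) :=
    (hφ.continuous_fderiv (by norm_num)).clm_apply continuous_const
  fun_prop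

theorem hasCompactSupport_divergence {φ : E d → E d} (hφ : HasCompactSupport φ) :
    HasCompactSupport (divergence φ) :=
  (hφ.fderiv ℝ).comp_left
    (g := fun L : E d →L[ℝ] E d => ∑ i : Fin d, (L (EuclideanSpace.single i 1)) i) (by simp)

/-- Integration by parts of a Lipschitz function against a divergence. -/
theorem integral_divergence_mul {f : E d → ℝ} {M : NNReal} (hf : LipschitzWith M f)
    {φ : E d → E d} (hφ : ContDiff ℝ 1 φ) (hc : HasCompactSupport φ) :
    ∫ x, divergence φ x * f x = ∫ x, -(fderiv ℝ f x (φ x)) := by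
  set e : Fin d → E d := fun i => EuclideanSpace.single i 1 with he
  have hci : ∀ i, HasCompactSupport fun x => φ x i := fun i =>
    hc.comp_left (g := fun v : E d => v i) rfl
  have hsm : ∀ i, ContDiff ℝ 1 fun x => φ x i := fun i => by fun_prop
  have hlin : ∀ x i, lineDeriv ℝ (fun x => φ x i) x (-e i) = -(fderiv ℝ φ x (e i)) i := by
    intro x i
    have hd : HasFDerivAt φ (fderiv ℝ φ x) x := (hφ.differentiable (by norm_num) x).hasFDerivAt
    have h1 : HasFDerivAt (fun x => φ x i) ((EuclideanSpace.proj i).comp (fderiv ℝ φ x)) x :=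
      (EuclideanSpace.proj (𝕜 := ℝ) i).hasFDerivAt.comp x hd
    rw [(h1.hasLineDerivAt (-e i)).lineDeriv]
    simp
  have hibp : ∀ i, ∫ x, lineDeriv ℝ f x (e i) * φ x i = ∫ x, -((fderiv ℝ φ x (e i)) i * f x) := by
    intro i
    obtain ⟨D, hD⟩ := ContDiff.lipschitzWith_of_hasCompactSupport (hci i) (hsm i) (by norm_num)
    rw [hf.integral_lineDeriv_mul_eq hD (hci i) (e i)]
    simp_rw [hlin, neg_mul]
  have hi1 : ∀ i ∈ Finset.univ, Integrable fun x => lineDeriv ℝ f x (e i) * φ x i := fun i _ =>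
    ((hsm i).continuous.integrable_of_hasCompactSupport (hci i)).mul_of_top_right
      (hf.memLp_lineDeriv (e i))
  have hi2 : ∀ i ∈ Finset.univ, Integrable fun x => -((fderiv ℝ φ x (e i)) i * f x) := by
    intro i _
    have h1 : Continuous fun x => fderiv ℝ φ x (e i) :=
      (hφ.continuous_fderiv (by norm_num)).clm_apply continuous_const
    have h2 : HasCompactSupport fun x => (fderiv ℝ φ x (e i)) i :=
      (hc.fderiv ℝ).comp_left (g := fun L : E d →L[ℝ] E d => (L (e i)) i) (by simp)
    refine (Continuous.integrable_of_hasCompactSupport ?_ (h2.mul_right (f' := f))).neg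
    exact Continuous.mul (by fun_prop) hf.continuous
  have hae : ∀ᵐ x, fderiv ℝ f x (φ x) = ∑ i, lineDeriv ℝ f x (e i) * φ x i := by
    filter_upwards [hf.ae_differentiableAt] with x hx
    have hs := (EuclideanSpace.basisFun (Fin d) ℝ).sum_repr (φ x)
    conv_lhs => rw [← hs]
    simp only [EuclideanSpace.basisFun_repr, EuclideanSpace.basisFun_apply, map_sum, map_smul,
      smul_eq_mul, hx.lineDeriv_eq_fderiv, he, mul_comm]
  rw [integral_neg, integral_congr_ae hae, integral_finsetSum _ hi1]
  simp_rw [hibp]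
  rw [← integral_finsetSum _ hi2, ← integral_neg]
  refine integral_congr_ae (Eventually.of_forall fun x => ?_)
  simp [divergence, Finset.sum_mul, he]

section Seminorm

variable (p : Seminorm ℝ (E d))

theorem abs_fderiv_affineCutoff_comp_le {ε : ℝ} (hε : 0 < ε) {x : E d}
    (hx : DifferentiableAt ℝ (fun x => affineCutoff ε (p x)) x) (v : E d) :
    |fderiv ℝ (fun x => affineCutoff ε (p x)) x v| ≤ ε⁻¹ * p v := by
  refine le_of_tendsto ((hx.hasFDerivAt.hasLineDerivAt v).tendsto_slope_zero_right).abs ?_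
  filter_upwards [self_mem_nhdsWithin] with s (hs : 0 < s)
  have h1 := (lipschitzWith_affineCutoff hε).dist_le_mul (p (x + s • v)) (p x)
  rw [Real.dist_eq, Real.dist_eq, Real.coe_toNNReal _ (by positivity)] at h1
  have h2 : |p (x + s • v) - p x| ≤ s * p v := by
    have := abs_sub_map_le_sub p (x + s • v) x
    rwa [add_sub_cancel_left, map_smul_eq_mul, Real.norm_eq_abs, abs_of_pos hs] at this
  rw [smul_eq_mul, abs_mul, abs_of_pos (inv_pos.2 hs), inv_mul_le_iff₀ hs]
  calc _ ≤ ε⁻¹ * (s * p v) := h1.trans (by gcongr)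
    _ = _ := by ring

/-- The divergence inequality for the unit ball, proved by integrating by parts against a Lipschitz
approximation of its indicator whose gradient is supported in the shell `1 ≤ p ≤ 1 + ε`. The volume
of this shell is `((1 + ε) ^ d - 1)` times that of the ball. -/
theorem integral_divergence_le {M : NNReal} (hlip : LipschitzWith M p)
    (hfin : volume {x | p x ≤ 1} ≠ ⊤) {φ : E d → E d} (hφ : ContDiff ℝ 1 φ)
    (hc : HasCompactSupport φ) (hφ1 : ∀ x, p (φ x) ≤ 1) :
    ∫ x in {x | p x ≤ 1}, divergence φ x ≤ d * (volume {x | p x ≤ 1}).toReal := by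
  have hp := hlip.continuous
  set C : Set (E d) := {x | p x ≤ 1} with hC
  have hCm : MeasurableSet C := measurableSet_le hp.measurable measurable_const
  set V : ℝ := (volume C).toReal with hV
  have hint : Integrable (divergence φ) :=
    (continuous_divergence hφ).integrable_of_hasCompactSupport (hasCompactSupport_divergence hc)
  have hle : ∀ ε : ℝ, 0 < ε → ∫ x, divergence φ x * affineCutoff ε (p x)
      ≤ ε⁻¹ * ((1 + ε) ^ d - 1) * V := by
    intro ε hε
    set A : Set (E d) := {x | p x ≤ 1 + ε} \ C with hA
    have hm : MeasurableSet {x | p x ≤ 1 + ε} := measurableSet_le hp.measurable measurable_const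
    have hAm : MeasurableSet A := hm.diff hCm
    have hvol : volume {x | p x ≤ 1 + ε} = ENNReal.ofReal ((1 + ε) ^ d) * volume C :=
      volume_seminorm_le p (by linarith)
    have hfin' : volume {x | p x ≤ 1 + ε} ≠ ⊤ := by
      rw [hvol]; exact ENNReal.mul_ne_top ENNReal.ofReal_ne_top hfin
    have hAV : (volume A).toReal = ((1 + ε) ^ d - 1) * V := by
      have hsub : C ⊆ {x | p x ≤ 1 + ε} := fun x (hx : p x ≤ 1) => hx.trans (by linarith)
      rw [hA, measure_sdiff hsub hCm.nullMeasurableSet hfin, ENNReal.toReal_sub_of_le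
        (measure_mono hsub) hfin', hvol, ENNReal.toReal_mul, ENNReal.toReal_ofReal (by positivity)]
      ring
    have hAfin : volume A ≠ ⊤ := ne_top_of_le_ne_top hfin' (measure_mono sdiff_subset)
    have hL := (lipschitzWith_affineCutoff hε).comp hlip
    have hlip' : LipschitzWith (Real.toNNReal ε⁻¹ * M) fun x => affineCutoff ε (p x) := hL
    rw [integral_divergence_mul hlip' hφ hc]
    have hae : ∀ᵐ x, -(fderiv ℝ (fun x => affineCutoff ε (p x)) x (φ x))
        ≤ A.indicator (fun _ => ε⁻¹) x := by
      have h1 : ∀ᵐ x : E d, p x ≠ 1 := by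
        rw [ae_iff]; simpa using volume_seminorm_eq_one p
      filter_upwards [hlip'.ae_differentiableAt, h1] with x hx hx1
      have hzero : ∀ c : ℝ, (∀ᶠ y in 𝓝 x, affineCutoff ε (p y) = c) → x ∉ A →
          -(fderiv ℝ (fun x => affineCutoff ε (p x)) x (φ x)) ≤ A.indicator (fun _ => ε⁻¹) x := by
        intro c h hxA
        have h2 : (fun x => affineCutoff ε (p x)) =ᶠ[𝓝 x] fun _ => c := h
        rw [h2.fderiv_eq, indicator_of_notMem hxA]
        simp
      rcases lt_or_gt_of_ne hx1 with h | h
      · exact hzero 1 ((hp.tendsto x).eventually_lt_const h |>.mono fun y hy =>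
          affineCutoff_of_le hε hy.le) fun hxA => hxA.2 h.le
      · rcases le_or_gt (p x) (1 + ε) with h' | h'
        · rw [indicator_of_mem (show x ∈ A from ⟨h', not_le.2 h⟩)]
          refine (neg_le_abs _).trans ((abs_fderiv_affineCutoff_comp_le p hε hx _).trans ?_)
          exact mul_le_of_le_one_right (by positivity) (hφ1 x)
        · exact hzero 0 ((hp.tendsto x).eventually_const_lt h' |>.mono fun y hy =>
            affineCutoff_of_ge hε hy.le) fun hxA => not_le.2 h' hxA.1
    have hI : ∫ x, A.indicator (fun _ => ε⁻¹) x = ε⁻¹ * ((1 + ε) ^ d - 1) * V := by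
      rw [integral_indicator hAm, setIntegral_const, smul_eq_mul, Measure.real, hAV]
      ring
    rw [← hI]
    have hI1 : Integrable fun x => -(fderiv ℝ (fun x => affineCutoff ε (p x)) x (φ x)) := by
      have hpφ : Integrable fun x => ε⁻¹ * p (φ x) :=
        ((hp.comp hφ.continuous).integrable_of_hasCompactSupport
          (hc.comp_left (map_zero p))).const_mul _
      have hms : Measurable fun x => fderiv ℝ (fun x => affineCutoff ε (p x)) x (φ x) :=
        (measurable_fderiv_apply_prod _).comp (hφ.continuous.measurable.prodMk measurable_id)
      refine hpφ.mono' hms.neg.aestronglyMeasurable ?_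
      filter_upwards [hlip'.ae_differentiableAt] with x hx
      rw [norm_neg]
      exact abs_fderiv_affineCutoff_comp_le p hε hx _
    exact integral_mono_ae hI1 ((integrable_indicator_iff hAm).2
      (integrableOn_const hAfin)) hae
  have hlim1 : Tendsto (fun ε : ℝ => ∫ x, divergence φ x * affineCutoff ε (p x)) (𝓝[>] 0)
      (𝓝 (∫ x in C, divergence φ x)) := by
    rw [← integral_indicator hCm]
    refine tendsto_integral_filter_of_dominated_convergence (fun x => ‖divergence φ x‖) ?_ ?_
      hint.norm ?_
    · filter_upwards [self_mem_nhdsWithin] with ε (hε : 0 < ε)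
      exact ((continuous_divergence hφ).mul
        ((lipschitzWith_affineCutoff hε).continuous.comp hp)).aestronglyMeasurable
    · refine Eventually.of_forall fun ε => Eventually.of_forall fun x => ?_
      rw [norm_mul]
      exact mul_le_of_le_one_right (norm_nonneg _) (abs_affineCutoff_le _ _)
    · refine Eventually.of_forall fun x => ?_
      by_cases hx : x ∈ C
      · rw [indicator_of_mem hx]
        refine tendsto_const_nhds.congr' ?_
        filter_upwards [self_mem_nhdsWithin] with ε (hε : 0 < ε)
        rw [affineCutoff_of_le hε hx, mul_one]
      · rw [indicator_of_notMem hx]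
        have hx : 1 < p x := not_le.1 hx
        refine tendsto_const_nhds.congr' ?_
        filter_upwards [Ioo_mem_nhdsGT (by linarith : 0 < p x - 1)] with ε hε
        rw [affineCutoff_of_ge hε.1 (by linarith [hε.2]), mul_zero]
  have hlim2 : Tendsto (fun ε : ℝ => ε⁻¹ * ((1 + ε) ^ d - 1) * V) (𝓝[>] 0) (𝓝 (d * V)) := by
    have h := (hasDerivAt_pow d (1 : ℝ)).tendsto_slope_zero_right
    simp only [one_pow, mul_one, smul_eq_mul] at h
    exact h.mul_const V
  refine le_of_tendsto_of_tendsto hlim1 hlim2 ?_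
  filter_upwards [self_mem_nhdsWithin] with ε hε using hle ε hε

open scoped Manifold in
/-- The radial field `x ↦ δ x`, cut off outside the ball of radius `δ⁻¹`. -/
theorem exists_field_integral_divergence_eq (hp : Continuous p)
    (hcomp : ∀ r : ℝ, IsCompact {x | p x ≤ r}) {δ : ℝ}
    (hδ : δ ∈ Ioo (0 : ℝ) 1) : ∃ φ : E d → E d, ContDiff ℝ 1 φ ∧ HasCompactSupport φ ∧
      (∀ x, p (φ x) ≤ 1) ∧
      ∫ x in {x | p x ≤ 1}, divergence φ x = δ * (d * (volume {x | p x ≤ 1}).toReal) := by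
  obtain ⟨hδ0, hδ1⟩ := hδ
  set C : Set (E d) := {x | p x ≤ 1} with hC
  have hCc : IsClosed C := isClosed_le hp continuous_const
  have hint : C ⊆ interior {x | p x ≤ δ⁻¹} := by
    have hsub : {x | p x < δ⁻¹} ⊆ {x | p x ≤ δ⁻¹} := fun y (hy : p y < δ⁻¹) => hy.le
    refine fun x (hx : p x ≤ 1) => interior_maximal hsub (isOpen_lt hp continuous_const) ?_
    exact hx.trans_lt (one_lt_inv₀ hδ0 |>.2 hδ1)
  obtain ⟨η, h1, h0, h01⟩ :=
    exists_contMDiffMap_one_nhds_of_subset_interior (n := 1) 𝓘(ℝ, E d) hCc hint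
  have hη : ContDiff ℝ 1 η := by simpa using η.contMDiff.contDiff
  refine ⟨fun x => (δ * η x) • x, by fun_prop, ?_, fun x => ?_, ?_⟩
  · refine HasCompactSupport.intro (hcomp δ⁻¹) fun x hx => ?_
    simp [h0 x hx]
  · rw [map_smul_eq_mul, Real.norm_eq_abs, abs_of_nonneg (mul_nonneg hδ0.le (h01 x).1)]
    by_cases hx : p x ≤ δ⁻¹
    · calc δ * η x * p x ≤ δ * 1 * δ⁻¹ := by
            gcongr
            · exact (h01 x).2
        _ = 1 := by field_simp
    · simp [h0 x hx]
  · have hdiv : ∀ x ∈ C, divergence (fun x => (δ * η x) • x) x = δ * d := by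
      intro x hx
      have hev : (fun x => (δ * η x) • x) =ᶠ[𝓝 x] fun x => δ • x := by
        filter_upwards [Filter.Eventually.filter_mono (nhds_le_nhdsSet hx) h1] with y hy
        rw [hy, mul_one]
      have hder : fderiv ℝ (fun x : E d => δ • x) x = δ • ContinuousLinearMap.id ℝ (E d) :=
        ((hasFDerivAt_id x).const_smul δ).fderiv
      rw [divergence, hev.fderiv_eq, hder]
      simp [mul_comm]
    rw [setIntegral_congr_fun hCc.measurableSet hdiv, setIntegral_const, smul_eq_mul, Measure.real]
    ring

end Seminorm

/-! ### The norm `σ_α` and its dual -/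

section Dual

variable {α : ℝ} {ν : Measure (E d)}

theorem spectralIntegral_le_one_iff (hα : 0 < α) (ξ : E d) :
    spectralIntegral α ν ξ ≤ 1 ↔ sigmaNorm α ν ξ ≤ 1 := by
  have h0 := spectralIntegral_nonneg (α := α) (ν := ν) ξ
  rw [sigmaNorm_eq]
  refine ⟨fun h => Real.rpow_le_one h0 h (by positivity), fun h => ?_⟩
  by_contra! h1
  exact absurd (Real.one_lt_rpow h1 (by positivity : 0 < 1 / α)) (not_lt.2 h)

theorem sigmaNorm_nonneg (ξ : E d) : 0 ≤ sigmaNorm α ν ξ :=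
  Real.rpow_nonneg (spectralIntegral_nonneg ξ) _

theorem sigmaNorm_smul (hα : 0 < α) (r : ℝ) (ξ : E d) :
    sigmaNorm α ν (r • ξ) = |r| * sigmaNorm α ν ξ := by
  rw [sigmaNorm_eq, sigmaNorm_eq, spectralIntegral_smul,
    Real.mul_rpow (by positivity) (spectralIntegral_nonneg ξ), ← Real.rpow_mul (abs_nonneg _),
    mul_one_div_cancel hα.ne', Real.rpow_one]

theorem convexOn_spectralIntegral (hα : 1 ≤ α) (hν : IsStableLevyMeasure α ν) :
    ConvexOn ℝ univ (spectralIntegral α ν) := by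
  have h0 : 0 < α := by linarith
  refine ⟨convex_univ, fun x _ y _ a b ha hb hab => ?_⟩
  have hx := integrable_spectral h0 hν x
  have hy := integrable_spectral h0 hν y
  simp only [spectralIntegral, smul_eq_mul]
  rw [← integral_const_mul, ← integral_const_mul, ← integral_add (hx.const_mul a) (hy.const_mul b)]
  refine integral_mono (integrable_spectral h0 hν _) ((hx.const_mul a).add (hy.const_mul b))
    fun z => ?_
  simp only [inner_add_right, inner_smul_right]
  have h1 : |a * inner ℝ (z : E d) x + b * inner ℝ (z : E d) y|
      ≤ a * |inner ℝ (z : E d) x| + b * |inner ℝ (z : E d) y| := by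
    refine (abs_add_le _ _).trans_eq ?_
    rw [abs_mul, abs_mul, abs_of_nonneg ha, abs_of_nonneg hb]
  refine (Real.rpow_le_rpow (abs_nonneg _) h1 h0.le).trans ?_
  have := (convexOn_rpow hα).2 (x := |inner ℝ (z : E d) x|) (mem_Ici.2 (abs_nonneg _))
    (y := |inner ℝ (z : E d) y|) (mem_Ici.2 (abs_nonneg _)) ha hb hab
  simpa using this

theorem convex_unitBall (hα : 1 ≤ α) (hν : IsStableLevyMeasure α ν) :
    Convex ℝ (unitBall α ν) := by
  have := (convexOn_spectralIntegral hα hν).convex_le 1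
  simpa [unitBall, spectralIntegral_le_one_iff (by linarith : 0 < α)] using this

theorem isClosed_unitBall (hα : 1 ≤ α) (hν : IsStableLevyMeasure α ν) :
    IsClosed (unitBall α ν) := by
  have hc : Continuous (spectralIntegral α ν) := by
    rw [← continuousOn_univ]
    exact (convexOn_spectralIntegral hα hν).continuousOn isOpen_univ
  have := isClosed_le hc continuous_const (f := spectralIntegral α ν) (g := fun _ => (1 : ℝ))
  simpa [unitBall, spectralIntegral_le_one_iff (by linarith : 0 < α)] using this

theorem zero_mem_unitBall (hα : 0 < α) : (0 : E d) ∈ unitBall α ν := by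
  have : sigmaNorm α ν 0 = 0 := by simpa using sigmaNorm_smul (α := α) (ν := ν) hα 0 0
  simp [unitBall, this]

theorem neg_mem_unitBall {z : E d} (hz : z ∈ unitBall α ν) : -z ∈ unitBall α ν := by
  simpa [unitBall, sigmaNorm_eq, spectralIntegral_neg] using hz

theorem exists_norm_le_mul_sigmaNorm (hα : 0 < α) (hnd : IsNondegenerate α ν) :
    ∃ R : NNReal, ∀ ξ : E d, ‖ξ‖ ≤ R * sigmaNorm α ν ξ := by
  set c : ℝ := ⨅ y : S d, spectralIntegral α ν (y : E d) with hc
  have hc0 : 0 < c := by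
    have h : 0 < ⨅ y : S d, ∫ x : S d, |inner ℝ (y : E d) (x : E d)| ^ α ∂(spectralMeasure α ν) :=
      hnd
    simpa only [hc, spectralIntegral, real_inner_comm] using h
  have hb : BddBelow (range fun y : S d => spectralIntegral α ν (y : E d)) :=
    ⟨0, by rintro _ ⟨y, rfl⟩; exact spectralIntegral_nonneg _⟩
  have hcp : 0 < c ^ (1 / α) := by positivity
  refine ⟨Real.toNNReal (c ^ (1 / α))⁻¹, fun ξ => ?_⟩
  rw [Real.coe_toNNReal _ (by positivity), inv_mul_eq_div, le_div_iff₀ hcp]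
  rcases eq_or_ne ξ 0 with rfl | hξ
  · simpa using sigmaNorm_nonneg _
  have hn : 0 < ‖ξ‖ := norm_pos_iff.2 hξ
  have h1 : c ^ (1 / α) ≤ sigmaNorm α ν (‖ξ‖⁻¹ • ξ) := by
    refine Real.rpow_le_rpow hc0.le ?_ (by positivity)
    exact ciInf_le hb ⟨‖ξ‖⁻¹ • ξ, by simp [norm_smul, hn.ne']⟩
  rw [sigmaNorm_smul hα, abs_of_pos (inv_pos.2 hn), inv_mul_eq_div, le_div_iff₀ hn] at h1
  linarith

theorem exists_sigmaNorm_le_mul_norm (hα : 0 < α) (hν : IsStableLevyMeasure α ν) :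
    ∃ M : ℝ, 0 < M ∧ ∀ ξ : E d, sigmaNorm α ν ξ ≤ M * ‖ξ‖ := by
  have := hν.isFiniteMeasure_spectralMeasure
  set m : ℝ := (spectralMeasure α ν).real univ with hm
  have hm0 : 0 ≤ m := measureReal_nonneg
  refine ⟨m ^ (1 / α) + 1, by positivity, fun ξ => ?_⟩
  have h1 : spectralIntegral α ν ξ ≤ m * ‖ξ‖ ^ α := by
    have h2 : spectralIntegral α ν ξ ≤ ∫ _ : S d, ‖ξ‖ ^ α ∂(spectralMeasure α ν) := by
      refine integral_mono (integrable_spectral hα hν ξ) (integrable_const _) fun y => ?_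
      refine Real.rpow_le_rpow (abs_nonneg _) ((abs_real_inner_le_norm _ _).trans ?_) hα.le
      simp
    simpa using h2
  have h3 : sigmaNorm α ν ξ ≤ m ^ (1 / α) * ‖ξ‖ := by
    refine (Real.rpow_le_rpow (spectralIntegral_nonneg ξ) h1 (by positivity)).trans_eq ?_
    rw [Real.mul_rpow hm0 (by positivity), ← Real.rpow_mul (norm_nonneg _),
      mul_one_div_cancel hα.ne', Real.rpow_one]
  nlinarith [norm_nonneg ξ]

theorem bddAbove_dual (hα : 0 < α) (hnd : IsNondegenerate α ν) (x : E d) :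
    BddAbove ((fun z : E d => |inner ℝ x z|) '' {z | sigmaNorm α ν z ≤ 1}) := by
  obtain ⟨R, hR⟩ := exists_norm_le_mul_sigmaNorm hα hnd
  refine ⟨‖x‖ * R, ?_⟩
  rintro _ ⟨z, hz, rfl⟩
  have hz : sigmaNorm α ν z ≤ 1 := hz
  refine (abs_real_inner_le_norm x z).trans (mul_le_mul_of_nonneg_left ?_ (norm_nonneg _))
  exact (hR z).trans (mul_le_of_le_one_right R.coe_nonneg hz)

theorem abs_inner_le_sigmaDual (hα : 0 < α) (hnd : IsNondegenerate α ν) (x : E d) {z : E d}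
    (hz : z ∈ unitBall α ν) : |inner ℝ x z| ≤ sigmaDual α ν x :=
  le_csSup (bddAbove_dual hα hnd x) ⟨z, hz, rfl⟩

theorem sigmaDual_le (hα : 0 < α) {x : E d} {c : ℝ}
    (h : ∀ z ∈ unitBall α ν, |inner ℝ x z| ≤ c) : sigmaDual α ν x ≤ c := by
  refine csSup_le ⟨_, 0, zero_mem_unitBall hα, rfl⟩ ?_
  rintro _ ⟨z, hz, rfl⟩
  exact h z hz

/-- The dual norm `σ_α^*` as a seminorm. -/
noncomputable def dualSeminorm (hα : 0 < α) (hnd : IsNondegenerate α ν) : Seminorm ℝ (E d) :=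
  Seminorm.ofSMulLE (sigmaDual α ν)
    (le_antisymm (sigmaDual_le hα fun z _ => by simp)
      ((abs_nonneg _).trans (abs_inner_le_sigmaDual hα hnd 0 (zero_mem_unitBall hα))))
    (fun x y => sigmaDual_le hα fun z hz => by
      rw [inner_add_left]
      exact (abs_add_le _ _).trans (add_le_add (abs_inner_le_sigmaDual hα hnd x hz)
        (abs_inner_le_sigmaDual hα hnd y hz)))
    (fun r x => sigmaDual_le hα fun z hz => by
      rw [real_inner_smul_left, abs_mul, Real.norm_eq_abs]
      exact mul_le_mul_of_nonneg_left (abs_inner_le_sigmaDual hα hnd x hz) (abs_nonneg r))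

theorem dualSeminorm_apply (hα : 0 < α) (hnd : IsNondegenerate α ν) (x : E d) :
    dualSeminorm hα hnd x = sigmaDual α ν x := rfl

/-- The unit ball of `σ_α` being symmetric, its polar set is the unit ball of the dual norm. -/
theorem polarBody_eq (hα : 0 < α) (hnd : IsNondegenerate α ν) :
    polarBody α ν = {x | dualSeminorm hα hnd x ≤ 1} := by
  ext x
  refine ⟨fun h => sigmaDual_le hα fun z hz => abs_le.2 ⟨?_, h z hz⟩, fun h z hz =>
    (le_abs_self _).trans ((abs_inner_le_sigmaDual hα hnd x hz).trans h)⟩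
  have := h (-z) (neg_mem_unitBall hz)
  rw [inner_neg_right] at this
  linarith

theorem exists_lipschitzWith_dualSeminorm (hα : 0 < α) (hnd : IsNondegenerate α ν) :
    ∃ R : NNReal, LipschitzWith R (dualSeminorm hα hnd) ∧ ∀ x, dualSeminorm hα hnd x ≤ R * ‖x‖ := by
  obtain ⟨R, hR⟩ := exists_norm_le_mul_sigmaNorm hα hnd
  have hle : ∀ x, dualSeminorm hα hnd x ≤ R * ‖x‖ := fun x => sigmaDual_le hα fun z hz => by
    rw [mul_comm]
    refine (abs_real_inner_le_norm x z).trans (mul_le_mul_of_nonneg_left ?_ (norm_nonneg _))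
    exact (hR z).trans (mul_le_of_le_one_right R.coe_nonneg hz)
  refine ⟨R, LipschitzWith.of_dist_le_mul fun x y => ?_, hle⟩
  rw [Real.dist_eq, dist_eq_norm]
  exact (abs_sub_map_le_sub (dualSeminorm hα hnd) x y).trans (hle _)

theorem exists_norm_le_dualSeminorm (hα : 0 < α) (hν : IsStableLevyMeasure α ν)
    (hnd : IsNondegenerate α ν) : ∃ M : ℝ, 0 < M ∧ ∀ x, ‖x‖ ≤ M * dualSeminorm hα hnd x := by
  obtain ⟨M, hM0, hM⟩ := exists_sigmaNorm_le_mul_norm hα hν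
  refine ⟨M, hM0, fun x => ?_⟩
  rcases eq_or_ne x 0 with rfl | hx
  · simp
  have hn : 0 < ‖x‖ := norm_pos_iff.2 hx
  have hz : ((M * ‖x‖)⁻¹ • x) ∈ unitBall α ν := by
    change sigmaNorm α ν _ ≤ 1
    rw [sigmaNorm_smul hα, abs_of_pos (by positivity), inv_mul_le_iff₀ (by positivity), mul_one]
    exact hM x
  have h1 := abs_inner_le_sigmaDual hα hnd x hz
  rw [real_inner_smul_right, real_inner_self_eq_norm_sq, abs_of_nonneg (by positivity)] at h1
  rw [dualSeminorm_apply, ← div_le_iff₀' hM0]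
  refine le_trans (le_of_eq ?_) h1
  field_simp

theorem isCompact_dualSeminorm_le (hα : 0 < α) (hν : IsStableLevyMeasure α ν)
    (hnd : IsNondegenerate α ν) (r : ℝ) : IsCompact {x | dualSeminorm hα hnd x ≤ r} := by
  obtain ⟨M, hM0, hM⟩ := exists_norm_le_dualSeminorm hα hν hnd
  obtain ⟨R, hR, -⟩ := exists_lipschitzWith_dualSeminorm hα hnd
  refine (isCompact_closedBall (0 : E d) (M * r)).of_isClosed_subset
    (isClosed_le hR.continuous continuous_const) fun x (hx : dualSeminorm hα hnd x ≤ r) => ?_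
  rw [mem_closedBall_zero_iff]
  exact (hM x).trans (mul_le_mul_of_nonneg_left hx hM0.le)

theorem abs_fderiv_seminorm_le (p : Seminorm ℝ (E d)) {x : E d} (hx : DifferentiableAt ℝ p x)
    (v : E d) : |fderiv ℝ p x v| ≤ p v := by
  refine le_of_tendsto ((hx.hasFDerivAt.hasLineDerivAt v).tendsto_slope_zero_right).abs ?_
  filter_upwards [self_mem_nhdsWithin] with s (hs : 0 < s)
  have := abs_sub_map_le_sub p (x + s • v) x
  rw [add_sub_cancel_left, map_smul_eq_mul, Real.norm_eq_abs, abs_of_pos hs] at this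
  rwa [smul_eq_mul, abs_mul, abs_of_pos (inv_pos.2 hs), inv_mul_le_iff₀ hs]

theorem fderiv_seminorm_self (p : Seminorm ℝ (E d)) {x : E d} (hx : DifferentiableAt ℝ p x) :
    fderiv ℝ p x x = p x := by
  refine tendsto_nhds_unique (hx.hasFDerivAt.hasLineDerivAt x).tendsto_slope_zero_right
    (tendsto_const_nhds.congr' ?_)
  filter_upwards [self_mem_nhdsWithin] with s (hs : 0 < s)
  have : x + s • x = (1 + s) • x := by rw [add_smul, one_smul]
  rw [this, map_smul_eq_mul, Real.norm_eq_abs, abs_of_pos (by linarith), smul_eq_mul]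
  field_simp
  ring

/-- The eikonal equation `σ_α(∇ σ_α^*) = 1`. The bound `≤ 1` is the bipolar theorem, and equality
holds as `σ_α^*` grows at unit rate along rays. -/
theorem exists_gradient_sigmaNorm_eq_one (hα : 1 ≤ α) (hα0 : 0 < α) (hν : IsStableLevyMeasure α ν)
    (hnd : IsNondegenerate α ν) {x : E d} (hx0 : x ≠ 0)
    (hx : DifferentiableAt ℝ (dualSeminorm hα0 hnd) x) :
    ∃ n : E d, sigmaNorm α ν n = 1 ∧ ∀ v, fderiv ℝ (dualSeminorm hα0 hnd) x v = inner ℝ v n := by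
  set p := dualSeminorm hα0 hnd with hp
  set n : E d := (InnerProductSpace.toDual ℝ (E d)).symm (fderiv ℝ p x) with hn
  have hin : ∀ v, fderiv ℝ p x v = inner ℝ v n := fun v => by
    rw [real_inner_comm, hn, InnerProductSpace.toDual_symm_apply]
  have hmem : n ∈ unitBall α ν := by
    by_contra hnot
    -- A functional separating `n` from the unit ball contradicts `|p'(x)| ≤ p`.
    obtain ⟨f, u, hf, hu⟩ := geometric_hahn_banach_closed_point (convex_unitBall hα hν)
      (isClosed_unitBall hα hν) hnot
    set z : E d := (InnerProductSpace.toDual ℝ (E d)).symm f with hz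
    have hfz : ∀ a, f a = inner ℝ z a := fun a => by
      rw [hz, InnerProductSpace.toDual_symm_apply]
    have hpz : p z ≤ u := sigmaDual_le hα0 fun a ha => by
      rw [← hfz, abs_le]
      have h1 := hf (-a) (neg_mem_unitBall ha)
      rw [map_neg] at h1
      exact ⟨by linarith, (hf a ha).le⟩
    have h2 := (le_abs_self _).trans (abs_fderiv_seminorm_le p hx z)
    rw [hin z, ← hfz] at h2
    linarith
  refine ⟨n, le_antisymm hmem ?_, hin⟩
  by_contra! hlt
  have hpx : 0 < p x := by
    obtain ⟨M, hM0, hM⟩ := exists_norm_le_dualSeminorm hα0 hν hnd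
    have h1 := hM x
    have h2 : 0 < ‖x‖ := norm_pos_iff.2 hx0
    exact pos_of_mul_pos_right (h2.trans_le h1) hM0.le
  have hN := sigmaNorm_nonneg (α := α) (ν := ν) n
  -- A dilate of `n` by a factor larger than `1` still lies in the unit ball.
  set t : ℝ := 2 / (1 + sigmaNorm α ν n) with ht
  have ht1 : 1 < t := by rw [ht, lt_div_iff₀ (by linarith)]; linarith
  have htn : t • n ∈ unitBall α ν := by
    change sigmaNorm α ν _ ≤ 1
    rw [sigmaNorm_smul hα0, abs_of_pos (by linarith), ht, div_mul_eq_mul_div,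
      div_le_one (by linarith)]
    linarith
  have h1 := (le_abs_self _).trans (abs_inner_le_sigmaDual hα0 hnd x htn)
  rw [real_inner_smul_right, ← hin, fderiv_seminorm_self p hx] at h1
  have h2 : t * p x ≤ p x := h1
  nlinarith

end Dual

/-! ### Heat content and perimeter of the polar body -/

section PolarBody

variable {α : ℝ} {ν μ : Measure (E d)}

theorem IsStableLaw.lintegral_norm_ne_top [IsProbabilityMeasure μ] (hα : α ∈ Ioo (1 : ℝ) 2)
    (hν : IsStableLevyMeasure α ν) (hsymm : IsSymmetric α ν) (hμ : IsStableLaw ν μ) :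
    ∫⁻ y, ENNReal.ofReal ‖y‖ ∂μ ≠ ⊤ := by
  have hle : ∀ y : E d, ENNReal.ofReal ‖y‖ ≤
      ∑ i : Fin d, ENNReal.ofReal |inner ℝ y (EuclideanSpace.single i 1)| := by
    intro y
    rw [← ENNReal.ofReal_sum_of_nonneg fun i _ => abs_nonneg _]
    refine ENNReal.ofReal_le_ofReal ?_
    have hs := (EuclideanSpace.basisFun (Fin d) ℝ).sum_repr y
    conv_lhs => rw [← hs]
    refine (norm_sum_le _ _).trans (Finset.sum_le_sum fun i _ => ?_)
    simp [norm_smul, EuclideanSpace.inner_single_right]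
  refine ne_top_of_le_ne_top ?_ (lintegral_mono hle)
  rw [lintegral_finsetSum _ fun i _ => by fun_prop]
  refine ENNReal.sum_ne_top.2 fun i _ => ?_
  rw [hμ.lintegral_abs_inner hα hν hsymm]
  exact ENNReal.ofReal_ne_top

/-- The heat content as an average of exit volumes, by Fubini and translation invariance. -/
theorem heatK_eq_lintegral_exitVolume [IsProbabilityMeasure μ] (p : Seminorm ℝ (E d))
    (hp : Continuous p) (hfin : ∀ s : ℝ, ∫⁻ y, exitVolume p (s • y) ∂μ ≠ ⊤) (t : ℝ) :
    heatK α μ t {x | p x ≤ 1} {x | p x ≤ 1}ᶜ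
      = (∫⁻ y, exitVolume p (t ^ (1 / α) • y) ∂μ).toReal := by
  set C : Set (E d) := {x | p x ≤ 1} with hC
  have hCm : MeasurableSet C := measurableSet_le hp.measurable measurable_const
  set s : ℝ := t ^ (1 / α) with hs
  set A : Set (E d × E d) := {q | q.1 ∉ C ∧ q.1 + s • q.2 ∈ C} with hA
  have hadd : Measurable fun q : E d × E d => q.1 + s • q.2 := by fun_prop
  have hAm : MeasurableSet A := (measurable_fst hCm.compl).inter (hadd hCm)
  have hind : ∀ x y, C.indicator (1 : E d → ℝ) (x + s • y) * Cᶜ.indicator 1 x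
      = A.indicator 1 (x, y) := by
    intro x y
    by_cases hx : x ∈ C <;> by_cases hy : x + s • y ∈ C <;> simp [hx, hy, hA]
  have hmeas : Measurable fun q : E d × E d => A.indicator (1 : E d × E d → ENNReal) q :=
    measurable_one.indicator hAm
  have hinner : ∀ x, heatSemigroup α μ t (C.indicator 1) x * Cᶜ.indicator 1 x
      = (∫⁻ y, A.indicator 1 (x, y) ∂μ).toReal := by
    intro x
    have hAx : MeasurableSet {y | (x, y) ∈ A} := measurable_prodMk_left hAm
    rw [heatSemigroup, ← integral_mul_const]
    simp_rw [← hs, hind]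
    have e1 : (fun y => A.indicator (1 : E d × E d → ℝ) (x, y))
        = {y | (x, y) ∈ A}.indicator 1 := rfl
    have e2 : (fun y => A.indicator (1 : E d × E d → ENNReal) (x, y))
        = {y | (x, y) ∈ A}.indicator 1 := rfl
    rw [e1, e2, integral_indicator_one hAx, lintegral_indicator_one hAx]
    rfl
  have hswap : ∫⁻ x, ∫⁻ y, A.indicator 1 (x, y) ∂μ = ∫⁻ y, exitVolume p (s • y) ∂μ := by
    rw [lintegral_lintegral_swap hmeas.aemeasurable]
    refine lintegral_congr fun y => ?_
    have hAy : MeasurableSet {x | (x, y) ∈ A} := measurable_prodMk_right hAm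
    have e2 : (fun x => A.indicator (1 : E d × E d → ENNReal) (x, y))
        = {x | (x, y) ∈ A}.indicator 1 := rfl
    rw [e2, lintegral_indicator_one hAy, exitVolume]
    conv_rhs => rw [← measure_preimage_add_right volume (s • y)]
    congr 1
    ext x
    simp [hA, hC, and_comm]
  rw [heatK]
  simp_rw [hinner]
  have hm1 : Measurable fun x => ∫⁻ y, A.indicator 1 (x, y) ∂μ := hmeas.lintegral_prod_right'
  rw [integral_toReal hm1.aemeasurable (ae_lt_top hm1 (by rw [hswap]; exact hfin s)), hswap]

/-- By the eikonal equation, the average of `(⟨∇ σ_α^* ; -y⟩)₊` over the stable law is constant. -/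
theorem lintegral_fderiv_dualSeminorm [IsProbabilityMeasure μ] (hd : 1 ≤ d)
    (hα : α ∈ Ioo (1 : ℝ) 2) (h0 : 0 < α)
    (hν : IsStableLevyMeasure α ν) (hsymm : IsSymmetric α ν) (hnd : IsNondegenerate α ν)
    (hμ : IsStableLaw ν μ) (C : Set (E d)) :
    ∫⁻ x in C, ∫⁻ y, ENNReal.ofReal (-(fderiv ℝ (dualSeminorm h0 hnd) x y)) ∂μ
      = ENNReal.ofReal (Real.Gamma (1 - 1 / α) / Real.pi) * volume C := by
  obtain ⟨R, hR, -⟩ := exists_lipschitzWith_dualSeminorm h0 hnd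
  have : Nonempty (Fin d) := ⟨⟨0, hd⟩⟩
  have h1 : ∀ᵐ x ∂(volume.restrict C), ∫⁻ y, ENNReal.ofReal
      (-(fderiv ℝ (dualSeminorm h0 hnd) x y)) ∂μ
      = ENNReal.ofReal (Real.Gamma (1 - 1 / α) / Real.pi) := by
    have hne : ∀ᵐ x : E d, x ≠ 0 := by simp [ae_iff]
    filter_upwards [ae_restrict_of_ae hR.ae_differentiableAt, ae_restrict_of_ae hne] with x hx hx0
    obtain ⟨n, hn, hin⟩ := exists_gradient_sigmaNorm_eq_one hα.1.le h0 hν hnd hx0 hx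
    simp_rw [hin]
    rw [hμ.lintegral_neg_inner hα hν hsymm, hn, mul_one]
  rw [lintegral_congr_ae h1, setLIntegral_const]

/-- Truncated radial fields approach the upper bound `d |C|` of the divergence inequality. -/
theorem perimeterVar_polarBody (h0 : 0 < α) (hν : IsStableLevyMeasure α ν)
    (hnd : IsNondegenerate α ν) :
    perimeterVar α ν (polarBody α ν) = ((d * (volume (polarBody α ν)).toReal : ℝ) : EReal) := by
  obtain ⟨R, hR, -⟩ := exists_lipschitzWith_dualSeminorm h0 hnd
  have hcomp := isCompact_dualSeminorm_le h0 hν hnd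
  rw [perimeterVar, polarBody_eq h0 hnd]
  refine le_antisymm (iSup₂_le ?_) ?_
  · rintro φ ⟨hφ, hc, hφ1⟩
    exact EReal.coe_le_coe_iff.2 (integral_divergence_le _ hR (hcomp 1).measure_ne_top hφ hc hφ1)
  -- Fields with divergence integral `δ d |C|` exist for every `δ < 1`; let `δ → 1`.
  · set W : ℝ := d * (volume {x | dualSeminorm h0 hnd x ≤ 1}).toReal with hW
    have hlim : Tendsto (fun δ : ℝ => ((δ * W : ℝ) : EReal)) (𝓝[<] 1) (𝓝 ((W : ℝ) : EReal)) := by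
      have h1 : Continuous fun δ : ℝ => ((δ * W : ℝ) : EReal) :=
        continuous_coe_real_ereal.comp (by fun_prop)
      simpa using (h1.tendsto 1).mono_left nhdsWithin_le_nhds
    refine le_of_tendsto hlim ?_
    filter_upwards [Ioo_mem_nhdsLT zero_lt_one] with δ hδ
    obtain ⟨φ, hφ, hc, hφ1, hint⟩ :=
      exists_field_integral_divergence_eq (dualSeminorm h0 hnd) hR.continuous hcomp hδ
    rw [← hint]
    exact le_iSup₂_of_le φ ⟨hφ, hc, hφ1⟩ le_rfl

end PolarBody

end StableHeat

theorem mainTheorem12 (d : ℕ) (hd : 1 ≤ d) (α : ℝ) (hα : α ∈ Set.Ioo (1 : ℝ) 2)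
    (ν : MeasureTheory.Measure (StableHeat.E d))
    (hν : StableHeat.IsStableLevyMeasure α ν)
    (hsymm : StableHeat.IsSymmetric α ν)
    (hnondeg : StableHeat.IsNondegenerate α ν)
    (μ : MeasureTheory.Measure (StableHeat.E d)) [MeasureTheory.IsProbabilityMeasure μ]
    (hμ : StableHeat.IsStableLaw ν μ) :
    MeasureTheory.volume (StableHeat.polarBody α ν) < ⊤ ∧
    Filter.Tendsto
      (fun t : ℝ => StableHeat.heatK α μ t (StableHeat.polarBody α ν) (StableHeat.polarBody α ν)ᶜ
        / t ^ (1 / α))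
      (nhdsWithin 0 (Set.Ioi 0))
      (nhds (Real.Gamma (1 - 1 / α) / Real.pi
        * (d * (MeasureTheory.volume (StableHeat.polarBody α ν)).toReal))) ∧
    ((Real.Gamma (1 - 1 / α) / Real.pi
        * (d * (MeasureTheory.volume (StableHeat.polarBody α ν)).toReal) : ℝ) : EReal)
      = ((Real.Gamma (1 - 1 / α) / Real.pi : ℝ) : EReal)
        * StableHeat.perimeterVar α ν (StableHeat.polarBody α ν) := by
  have h0 : 0 < α := by linarith [hα.1]
  obtain ⟨R, hR, hRle⟩ := StableHeat.exists_lipschitzWith_dualSeminorm h0 hnondeg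
  set p := StableHeat.dualSeminorm h0 hnondeg with hp
  have hbody : StableHeat.polarBody α ν = {x | p x ≤ 1} := StableHeat.polarBody_eq h0 hnondeg
  have hfin : volume {x | p x ≤ 1} ≠ ⊤ :=
    (StableHeat.isCompact_dualSeminorm_le h0 hν hnondeg 1).measure_ne_top
  refine ⟨by rw [hbody]; exact hfin.lt_top, ?_, ?_⟩
  · have hG : 0 < Real.Gamma (1 - 1 / α) := by
      refine Real.Gamma_pos_of_pos ?_
      rw [sub_pos, div_lt_one h0]
      exact hα.1
    have hmom : ∫⁻ y, ENNReal.ofReal (p y) ∂μ ≠ ⊤ := by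
      refine ne_top_of_le_ne_top ?_ (lintegral_mono fun y => ENNReal.ofReal_le_ofReal (hRle y))
      simp_rw [ENNReal.ofReal_mul R.coe_nonneg]
      rw [lintegral_const_mul _ (by fun_prop)]
      exact ENNReal.mul_ne_top ENNReal.ofReal_ne_top (hμ.lintegral_norm_ne_top hα hν hsymm)
    have hK : ∀ s : ℝ, ∫⁻ y, StableHeat.exitVolume p (s • y) ∂μ ≠ ⊤ := by
      intro s
      have hle : ∀ y, StableHeat.exitVolume p (s • y) ≤ volume {x | p x ≤ 1} := fun y =>
        measure_mono fun x hx => hx.1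
      exact ne_top_of_le_ne_top (by simpa using hfin) (lintegral_mono hle)
    have hmain := StableHeat.tendsto_lintegral_exitVolume_div p μ hd hR hfin hmom
    rw [StableHeat.lintegral_fderiv_dualSeminorm hd hα h0 hν hsymm hnondeg hμ, ENNReal.toReal_mul,
      ENNReal.toReal_ofReal (by positivity)] at hmain
    have hpow : Tendsto (fun t : ℝ => t ^ (1 / α)) (𝓝[>] 0) (𝓝[>] 0) := by
      refine tendsto_nhdsWithin_iff.2 ⟨?_, ?_⟩
      · have h1 : Continuous fun t : ℝ => t ^ (1 / α) :=
          Real.continuous_rpow_const (by positivity)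
        have h2 := h1.tendsto 0
        rw [Real.zero_rpow (by positivity)] at h2
        exact h2.mono_left nhdsWithin_le_nhds
      · filter_upwards [self_mem_nhdsWithin] with t ht
        exact Real.rpow_pos_of_pos ht _
    rw [hbody]
    simp_rw [StableHeat.heatK_eq_lintegral_exitVolume p hR.continuous hK]
    rw [mul_left_comm]
    exact hmain.comp hpow
  · rw [StableHeat.perimeterVar_polarBody h0 hν hnondeg, EReal.coe_mul]
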